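/- Let $\lambda>-1$ and $t\in\mathbb{R}$, and let $P_n(x)=P_n(x;t,\lambda)$, $n\ge 0$, be the monic orthogonal polynomials, $\deg P_n=n$, with respect to the generalised sextic Freud weight $\omega(x;t,\lambda)=|x|^{2\lambda+1}\exp(-x^6+tx^2)$, $x\in\mathbb{R}$. Let $\beta_n(t;\lambda)$ be the coefficients in the recurrence $P_{n+1}(x)=xP_n(x)-\beta_n(t;\lambda)P_{n-1}(x)$, that is, $$\beta_n=\frac1{h_{n-1}}\int_{-\infty}^{\infty}xP_{n-1}(x)P_n(x)\,\omega(x;t,\lambda)\,dx,\qquad h_{n}=\int_{-\infty}^{\infty}P_{n}(x)^2\,\omega(x;t,\lambda)\,dx,\qquad n\ge1,$$ with $\beta_0=0$. Then for every fixed $\lambda>-1$ and every fixed integer $n\ge 0$, as $t\to+\infty$, $$\beta_{2n}(t;\lambda)=\frac{n}{2t}+\frac{3\sqrt3\,n(2n-2\lambda-1)}{8\,t^{5/2}}+\mathcal{O}(t^{-4}),$$ $$\beta_{2n+1}(t;\lambda)=\tfrac13\sqrt{3t}-\frac{4n-2\lambda+1}{4t}-\frac{\sqrt3\,(36n^2-72\lambda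 n+12\lambda^2-24\lambda+5)}{32\,t^{5/2}}+\mathcal{O}(t^{-4}),$$ and, as $t\to-\infty$, $$\beta_{2n}(t;\lambda)=-\frac{n}{t}-\frac{3n\left[10n^2+6(2\lambda+1)n+3\lambda^2+3\lambda+2\right]}{t^{4}}+\mathcal{O}(t^{-7}),$$ $$\beta_{2n+1}(t;\lambda)=-\frac{n+\lambda+1}{t}-\frac{3(n+\lambda+1)\left[10n^2+(8\lambda+14)n+(\lambda+3)(\lambda+2)\right]}{t^{4}}+\mathcal{O}(t^{-7}).$$ -/

import Mathlib

open Filter Asymptotics MeasureTheory Polynomial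

noncomputable section

namespace SexticFreud

/-- The generalised sextic Freud weight `|x|^(2λ+1) exp(-x^6 + t x^2)` on the real line. -/
def weight (lam t x : ℝ) : ℝ :=
  |x| ^ (2 * lam + 1) * Real.exp (-x ^ 6 + t * x ^ 2)

/-- The bilinear form `∫ p(x) q(x) w(x) dx` on real polynomials. -/
def pairing (w : ℝ → ℝ) (p q : ℝ[X]) : ℝ :=
  ∫ x, p.eval x * q.eval x * w x

/-- The monic orthogonal polynomial of degree `n` for the weight `w`
(the monomials, orthogonalised one after the other). -/
def monicOP (w : ℝ → ℝ) (n : ℕ) : ℝ[X] :=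
  X ^ n - ∑ k : Fin n,
    C (pairing w (X ^ n) (monicOP w k) / pairing w (monicOP w k) (monicOP w k)) * monicOP w k
termination_by n
decreasing_by all_goals exact k.2

/-- The normalisation constant `h_n = ∫ P_n(x)^2 w(x) dx`. -/
def normConst (w : ℝ → ℝ) (n : ℕ) : ℝ :=
  pairing w (monicOP w n) (monicOP w n)

/-- The recurrence coefficient `β_n = (1 / h_{n-1}) ∫ x P_{n-1}(x) P_n(x) w(x) dx` for `n ≥ 1`,
with `β_0 = 0`.  For an even weight it is the coefficient in
`P_{n+1}(x) = x P_n(x) - β_n P_{n-1}(x)`; see `monicOP_recurrence` below for `weight`. -/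
def recCoeff (w : ℝ → ℝ) : ℕ → ℝ
  | 0 => 0
  | n + 1 => pairing w (X * monicOP w n) (monicOP w (n + 1)) / normConst w n

/-- The recurrence coefficient `β_n(t; λ)` of the generalised sextic Freud weight. -/
def beta (lam : ℝ) (n : ℕ) (t : ℝ) : ℝ :=
  recCoeff (weight lam t) n

section Helpers

variable {w : ℝ → ℝ}

theorem pairing_comm (w : ℝ → ℝ) (p q : ℝ[X]) : pairing w p q = pairing w q p := by
  simp only [pairing, mul_comm]

theorem pairing_mul_left (w : ℝ → ℝ) (p q r : ℝ[X]) :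
    pairing w (r * p) q = pairing w p (r * q) := by
  simp only [pairing, eval_mul]
  congr 1
  ext x
  ring

theorem pairing_C_mul_left (w : ℝ → ℝ) (c : ℝ) (p q : ℝ[X]) :
    pairing w (C c * p) q = c * pairing w p q := by
  simp only [pairing, eval_mul, eval_C]
  rw [← integral_const_mul]
  congr 1
  ext x
  ring

theorem pairing_add_left (hint : ∀ p : ℝ[X], Integrable fun x => p.eval x * w x) (p q r : ℝ[X]) :
    pairing w (p + q) r = pairing w p r + pairing w q r := by
  have h1 := hint (p * r)
  have h2 := hint (q * r)
  simp only [eval_mul] at h1 h2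
  rw [pairing, pairing, pairing, ← integral_add h1 h2]
  congr 1
  ext x
  simp only [eval_add]
  ring

theorem pairing_sub_left (hint : ∀ p : ℝ[X], Integrable fun x => p.eval x * w x) (p q r : ℝ[X]) :
    pairing w (p - q) r = pairing w p r - pairing w q r := by
  have h : p - q = p + C (-1) * q := by simp [sub_eq_add_neg]
  rw [h, pairing_add_left hint, pairing_C_mul_left]
  ring

theorem pairing_sum_left (hint : ∀ p : ℝ[X], Integrable fun x => p.eval x * w x)
    {ι : Type*} (s : Finset ι) (f : ι → ℝ[X]) (r : ℝ[X]) :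
    pairing w (∑ i ∈ s, f i) r = ∑ i ∈ s, pairing w (f i) r := by
  classical
  induction s using Finset.induction_on with
  | empty => simp [pairing]
  | insert a s ha ih => rw [Finset.sum_insert ha, Finset.sum_insert ha, pairing_add_left hint, ih]

theorem degree_C_mul_le_aux (c : ℝ) (p : ℝ[X]) : (C c * p).degree ≤ p.degree := by
  rw [← smul_eq_C_mul]
  exact degree_smul_le c p

theorem coeff_comp_neg_X_aux (p : ℝ[X]) (m : ℕ) :
    (p.comp (-X)).coeff m = (-1) ^ m * p.coeff m := by
  have h : (-X : ℝ[X]) = C (-1) * X := by simp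
  rw [h, comp_C_mul_X_coeff, mul_comm]

theorem monicOP_monic_degree (w : ℝ → ℝ) (n : ℕ) :
    (monicOP w n).Monic ∧ (monicOP w n).degree = n := by
  induction n using Nat.strong_induction_on with
  | _ n ih =>
    have hlt : (∑ k : Fin n, C (pairing w (X ^ n) (monicOP w k) /
        pairing w (monicOP w k) (monicOP w k)) * monicOP w k).degree < (n : WithBot ℕ) := by
      refine (degree_sum_le _ _).trans_lt ((Finset.sup_lt_iff (WithBot.bot_lt_coe n)).2 ?_)
      intro k _
      refine (degree_C_mul_le_aux _ _).trans_lt ?_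
      rw [(ih k k.2).2]
      exact Nat.cast_lt.2 k.2
    rw [monicOP]
    constructor
    · exact (monic_X_pow n).sub_of_left (by simpa using hlt)
    · rw [degree_sub_eq_left_of_degree_lt (by simpa using hlt), degree_X_pow]

/-- The constructed polynomials are pairwise orthogonal. -/
theorem pairing_monicOP_eq_zero_of_lt
    (hint : ∀ p : ℝ[X], Integrable fun x => p.eval x * w x)
    (hpos : ∀ p : ℝ[X], p ≠ 0 → 0 < pairing w p p) (n : ℕ) :
    ∀ k < n, pairing w (monicOP w n) (monicOP w k) = 0 := by
  induction n using Nat.strong_induction_on with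
  | _ n ih =>
    intro k hk
    rw [monicOP, pairing_sub_left hint, pairing_sum_left hint,
      Finset.sum_eq_single (⟨k, hk⟩ : Fin n)]
    · rw [pairing_C_mul_left, div_mul_cancel₀ _ (hpos _ (monicOP_monic_degree w k).1.ne_zero).ne',
        sub_self]
    · intro j _ hj
      rw [pairing_C_mul_left]
      rcases lt_trichotomy (j : ℕ) k with h | h | h
      · rw [pairing_comm w (monicOP w j) (monicOP w k), ih k hk j h, mul_zero]
      · exact absurd (Fin.ext h) hj
      · rw [ih j j.2 k h, mul_zero]
    · simp

theorem pairing_eq_zero_of_degree_lt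
    (hint : ∀ p : ℝ[X], Integrable fun x => p.eval x * w x) (r : ℝ[X]) (n : ℕ)
    (hr : ∀ k < n, pairing w (monicOP w k) r = 0) (q : ℝ[X]) (hq : q.degree < n) :
    pairing w q r = 0 := by
  induction n generalizing q with
  | zero =>
    have : q = 0 := by simpa using hq
    simp [this, pairing]
  | succ n ih =>
    have hq' : q.degree ≤ n := by
      rw [degree_le_iff_coeff_zero]
      rw [degree_lt_iff_coeff_zero] at hq
      intro m hm
      exact hq m (by exact_mod_cast hm)
    have hd : (q - C (q.coeff n) * monicOP w n).degree < n := by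
      rw [degree_lt_iff_coeff_zero]
      intro m hm
      have hP := monicOP_monic_degree w n
      have hnat : (monicOP w n).natDegree = n := natDegree_eq_of_degree_eq_some hP.2
      rcases hm.eq_or_lt with rfl | hlt
      · have : (monicOP w n).coeff n = 1 := by
          have := hP.1.coeff_natDegree
          rwa [hnat] at this
        simp [this]
      · have h1 : q.coeff m = 0 := coeff_eq_zero_of_degree_lt (hq'.trans_lt (by exact_mod_cast hlt))
        have h2 : (monicOP w n).coeff m = 0 := coeff_eq_zero_of_natDegree_lt (by omega)
        simp [h1, h2]
    have h := ih (fun k hk => hr k (by omega)) _ hd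
    rw [pairing_sub_left hint, pairing_C_mul_left, hr n (by omega)] at h
    linarith

theorem monicOP_comp_neg
    (hint : ∀ p : ℝ[X], Integrable fun x => p.eval x * w x)
    (hpos : ∀ p : ℝ[X], p ≠ 0 → 0 < pairing w p p) (heven : ∀ x, w (-x) = w x) (n : ℕ) :
    C ((-1) ^ n) * (monicOP w n).comp (-X) = monicOP w n := by
  have hflip : ∀ p q : ℝ[X], pairing w (p.comp (-X)) q = pairing w p (q.comp (-X)) := by
    intro p q
    rw [pairing, pairing, ← integral_neg_eq_self]
    simp [heven]
  have horth : ∀ q : ℝ[X], q.degree < n → pairing w q (monicOP w n) = 0 :=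
    pairing_eq_zero_of_degree_lt hint _ n fun k hk => by
      rw [pairing_comm]; exact pairing_monicOP_eq_zero_of_lt hint hpos n k hk
  have hP := monicOP_monic_degree w n
  have hnat : (monicOP w n).natDegree = n := natDegree_eq_of_degree_eq_some hP.2
  have hcomp : ∀ q : ℝ[X], (q.comp (-X)).natDegree = q.natDegree := by
    intro q
    simp [natDegree_comp]
  have hco : ((monicOP w n).comp (-X)).coeff n = (-1) ^ n := by
    rw [coeff_comp_neg_X_aux]
    have := hP.1.coeff_natDegree
    rw [hnat] at this
    simp [this]
  set D := C ((-1) ^ n) * (monicOP w n).comp (-X) - monicOP w n with hD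
  have hDdeg : D.degree < n := by
    rw [degree_lt_iff_coeff_zero]
    intro m hm
    rcases hm.eq_or_lt with rfl | hlt
    · have := hP.1.coeff_natDegree
      rw [hnat] at this
      rw [hD, coeff_sub, coeff_C_mul, hco, this, ← mul_pow]
      simp
    · rw [hD, coeff_sub, coeff_C_mul, coeff_eq_zero_of_natDegree_lt (n := m),
        coeff_eq_zero_of_natDegree_lt (n := m)]
      · simp
      · omega
      · rw [hcomp]; omega
  have hDflip : (D.comp (-X)).degree < n := by
    rw [degree_lt_iff_coeff_zero] at hDdeg ⊢
    intro m hm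
    rw [coeff_comp_neg_X_aux, hDdeg m hm, mul_zero]
  have hzero : pairing w D D = 0 := by
    conv_lhs => rw [hD]
    rw [pairing_sub_left hint, pairing_C_mul_left, hflip, pairing_comm w _ (D.comp _),
      pairing_comm w _ D, horth _ hDdeg, horth _ hDflip]
    simp
  by_contra hne
  have := hpos D (by rw [hD]; exact sub_ne_zero.2 hne)
  linarith

/-- The three-term recurrence for an even weight, whose coefficients are `recCoeff`. -/
theorem monicOP_recurrence_of_even
    (hint : ∀ p : ℝ[X], Integrable fun x => p.eval x * w x)
    (hpos : ∀ p : ℝ[X], p ≠ 0 → 0 < pairing w p p) (heven : ∀ x, w (-x) = w x) (n : ℕ) :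
    monicOP w (n + 2) = X * monicOP w (n + 1) - C (recCoeff w (n + 1)) * monicOP w n := by
  have horth : ∀ n : ℕ, ∀ q : ℝ[X], q.degree < n → pairing w q (monicOP w n) = 0 := fun n =>
    pairing_eq_zero_of_degree_lt hint _ n fun k hk => by
      rw [pairing_comm]; exact pairing_monicOP_eq_zero_of_lt hint hpos n k hk
  have hP := monicOP_monic_degree w
  have hdiag : pairing w (X * monicOP w (n + 1)) (monicOP w (n + 1)) = 0 := by
    have hev : ∀ x : ℝ, (monicOP w (n + 1)).eval (-x) ^ 2 = (monicOP w (n + 1)).eval x ^ 2 := by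
      intro x
      have h := congrArg (eval x) (monicOP_comp_neg hint hpos heven (n + 1))
      simp only [eval_mul, eval_C, eval_comp, eval_neg, eval_X] at h
      rw [← h, mul_pow, ← pow_mul, mul_comm (n + 1) 2, pow_mul]
      simp
    have h : pairing w (X * monicOP w (n + 1)) (monicOP w (n + 1))
        = - pairing w (X * monicOP w (n + 1)) (monicOP w (n + 1)) := by
      conv_lhs => rw [pairing, ← integral_neg_eq_self]
      rw [pairing, ← integral_neg]
      congr 1
      ext x
      simp only [eval_mul, eval_X, heven]
      linear_combination (-x * w x) * hev x
    linarith
  have hXdeg : ∀ k, (X * monicOP w k).degree = ((k + 1 : ℕ) : WithBot ℕ) := by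
    intro k
    rw [degree_mul, degree_X, (hP k).2]
    push_cast
    ring
  set R := monicOP w (n + 2) - (X * monicOP w (n + 1) - C (recCoeff w (n + 1)) * monicOP w n)
    with hR
  have hRdeg : R.degree < ((n + 2 : ℕ) : WithBot ℕ) := by
    have h1 : (monicOP w (n + 2) - X * monicOP w (n + 1)).degree < (monicOP w (n + 2)).degree := by
      refine degree_sub_lt_left ?_ (hP _).1.ne_zero ?_
      · rw [(hP _).2, hXdeg]
      · rw [(hP _).1.leadingCoeff, (monic_X.mul (hP _).1).leadingCoeff]
    rw [(hP _).2] at h1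
    have h2 : (C (recCoeff w (n + 1)) * monicOP w n).degree < ((n + 2 : ℕ) : WithBot ℕ) := by
      refine (degree_C_mul_le_aux _ _).trans_lt ?_
      rw [(hP _).2]
      exact_mod_cast (by omega : n < n + 2)
    have : R = (monicOP w (n + 2) - X * monicOP w (n + 1)) + C (recCoeff w (n + 1)) * monicOP w n := by
      rw [hR]; ring
    rw [this]
    exact (degree_add_le _ _).trans_lt (max_lt h1 h2)
  have hRk : ∀ k < n + 2, pairing w (monicOP w k) R = 0 := by
    intro k hk
    rw [pairing_comm, hR, pairing_sub_left hint, pairing_sub_left hint, pairing_C_mul_left,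
      pairing_monicOP_eq_zero_of_lt hint hpos (n + 2) k hk]
    rcases (by omega : k = n + 1 ∨ k = n ∨ k < n) with rfl | rfl | hlt
    · rw [hdiag, pairing_comm, pairing_monicOP_eq_zero_of_lt hint hpos (n + 1) n (by omega)]
      simp
    · have hh := (hpos _ (hP k).1.ne_zero).ne'
      rw [pairing_mul_left, pairing_comm w (monicOP w (k + 1)), recCoeff, normConst,
        div_mul_cancel₀ _ hh]
      simp
    · rw [pairing_mul_left, pairing_comm,
        horth (n + 1) _ (by rw [hXdeg]; exact_mod_cast (by omega : k + 1 < n + 1)),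
        pairing_monicOP_eq_zero_of_lt hint hpos n k hlt]
      simp
  by_contra hne
  have h1 := hpos R (sub_ne_zero.2 hne)
  have h2 := pairing_eq_zero_of_degree_lt hint R (n + 2) hRk R hRdeg
  linarith

theorem weight_neg (lam t x : ℝ) : weight lam t (-x) = weight lam t x := by
  rw [weight, weight, abs_neg, Even.neg_pow (by decide), Even.neg_pow (by decide)]

theorem integrable_abs_rpow_mul_exp_neg_sq {s : ℝ} (hs : -1 < s) :
    Integrable fun x : ℝ => |x| ^ s * Real.exp (-x ^ 2) := by
  have h : IntegrableOn (fun x : ℝ => |x| ^ s * Real.exp (-x ^ 2)) (Set.Ioi 0) := by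
    refine (integrableOn_rpow_mul_exp_neg_mul_sq one_pos hs).congr_fun ?_ measurableSet_Ioi
    intro x hx
    simp [abs_of_pos (Set.mem_Ioi.1 hx)]
  rw [← integrableOn_univ, ← Set.Iic_union_Ioi (a := (0 : ℝ)), integrableOn_union]
  refine ⟨?_, h⟩
  have h' := (integrableOn_Ici_iff_integrableOn_Ioi (μ := volume)).2 h
  rw [← neg_zero, ← integrableOn_Ici_iff_integrableOn_Ioi] at h
  have h2 := h.comp_neg_Iic
  simpa using h2

theorem integrable_eval_mul_weight {lam : ℝ} (hlam : -1 < lam) (t : ℝ) (p : ℝ[X]) :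
    Integrable fun x => p.eval x * weight lam t x := by
  have hmeas : Measurable (weight lam t) := by
    unfold weight
    fun_prop
  induction p using Polynomial.induction_on' with
  | add p q hp hq =>
    simp only [eval_add, add_mul]
    exact hp.add hq
  | monomial k c =>
    have hs : -1 < 2 * lam + 1 + k := by
      have : (0 : ℝ) ≤ k := Nat.cast_nonneg k
      linarith
    set a : ℝ := |t| + 1 with ha
    refine ((integrable_abs_rpow_mul_exp_neg_sq hs).const_mul (|c| * Real.exp (a ^ 2))).mono'
      ((Polynomial.continuous _).measurable.mul hmeas).aestronglyMeasurable ?_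
    have h0 : ∀ᵐ x : ℝ, x ≠ 0 := by simp [ae_iff]
    filter_upwards [h0] with x hx
    have hxp : 0 < |x| := abs_pos.2 hx
    have hexp : -x ^ 6 + t * x ^ 2 ≤ a ^ 2 + -x ^ 2 := by
      have hy : 0 ≤ x ^ 2 := sq_nonneg x
      have h1 : t * x ^ 2 ≤ |t| * x ^ 2 := mul_le_mul_of_nonneg_right (le_abs_self t) hy
      have ha1 : 1 ≤ a := by rw [ha]; linarith [abs_nonneg t]
      have h2 : a * x ^ 2 ≤ a ^ 2 + (x ^ 2) ^ 3 := by
        rcases le_total (x ^ 2) a with h | h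
        · nlinarith [pow_nonneg hy 3]
        · have : x ^ 2 ≤ (x ^ 2) ^ 2 := by nlinarith
          nlinarith [sq_nonneg a]
      have h3 : (x ^ 2) ^ 3 = x ^ 6 := by ring
      nlinarith
    rw [weight, eval_monomial, Real.norm_eq_abs, abs_mul, abs_mul, abs_mul, abs_pow, Real.abs_exp,
      abs_of_nonneg (Real.rpow_nonneg (abs_nonneg x) _), Real.rpow_add_natCast hxp.ne']
    have : Real.exp (-x ^ 6 + t * x ^ 2) ≤ Real.exp (a ^ 2) * Real.exp (-x ^ 2) := by
      rw [← Real.exp_add]; exact Real.exp_le_exp.2 hexp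
    calc |c| * |x| ^ k * (|x| ^ (2 * lam + 1) * Real.exp (-x ^ 6 + t * x ^ 2))
        ≤ |c| * |x| ^ k * (|x| ^ (2 * lam + 1) * (Real.exp (a ^ 2) * Real.exp (-x ^ 2))) := by
          gcongr
      _ = _ := by ring

theorem pairing_weight_self_pos {lam : ℝ} (hlam : -1 < lam) (t : ℝ) (p : ℝ[X]) (hp : p ≠ 0) :
    0 < pairing (weight lam t) p p := by
  have hw : ∀ x, 0 ≤ weight lam t x := fun x =>
    mul_nonneg (Real.rpow_nonneg (abs_nonneg x) _) (Real.exp_pos _).le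
  have hi := integrable_eval_mul_weight hlam t (p * p)
  simp only [eval_mul] at hi
  rw [pairing, integral_pos_iff_support_of_nonneg
    (fun x => mul_nonneg (mul_self_nonneg _) (hw x)) hi]
  have hfin : {x : ℝ | (X * p).IsRoot x}.Finite :=
    finite_setOfPred_isRoot (mul_ne_zero X_ne_zero hp)
  have hsub : {x : ℝ | (X * p).IsRoot x}ᶜ ⊆
      Function.support fun x => p.eval x * p.eval x * weight lam t x := by
    intro x hx
    simp only [Set.mem_compl_iff, Set.mem_ofPred_eq, IsRoot, eval_mul, eval_X, mul_eq_zero,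
      not_or] at hx
    have : 0 < weight lam t x :=
      mul_pos (Real.rpow_pos_of_pos (abs_pos.2 hx.1) _) (Real.exp_pos _)
    simp [hx.2, this.ne']
  refine lt_of_lt_of_le ?_ (measure_mono hsub)
  rw [measure_compl hfin.measurableSet (by rw [hfin.measure_zero]; simp), hfin.measure_zero]
  simp

/-- The polynomials `monicOP (weight lam t)` are orthogonal for the sextic Freud weight. -/
theorem monicOP_orthogonal {lam : ℝ} (hlam : -1 < lam) (t : ℝ) (m n : ℕ) :
    pairing (weight lam t) (monicOP (weight lam t) m) (monicOP (weight lam t) n)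
      = if m = n then normConst (weight lam t) n else 0 := by
  have h := pairing_monicOP_eq_zero_of_lt (integrable_eval_mul_weight hlam t)
    (pairing_weight_self_pos hlam t)
  rcases lt_trichotomy m n with hmn | rfl | hmn
  · rw [if_neg hmn.ne, pairing_comm, h n m hmn]
  · simp [normConst]
  · rw [if_neg hmn.ne', h m n hmn]

/-- The recurrence `P_{n+2} = x P_{n+1} - β_{n+1} P_n` for the sextic Freud weight. -/
theorem monicOP_recurrence {lam : ℝ} (hlam : -1 < lam) (t : ℝ) (n : ℕ) :
    monicOP (weight lam t) (n + 2) = X * monicOP (weight lam t) (n + 1)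
      - C (beta lam (n + 1) t) * monicOP (weight lam t) n :=
  monicOP_recurrence_of_even (integrable_eval_mul_weight hlam t)
    (pairing_weight_self_pos hlam t) (weight_neg lam t) n

end Helpers

end SexticFreud

end

noncomputable section

namespace SexticFreud

/-! In the variable u = x² the weight becomes u^λ exp(-u³ + tu) on u > 0. The ratios β_n = h_n /
h_{n-1} obey the Volterra lattice β_n' = β_n (β_{n+1} - β_{n-1}) in t (`hasDerivAt_beta`). Hence
β_{n+1} = β_{n-1} + β_n' / β_n, and all coefficients follow from β_0 = 0 and from β_1, the mean E[u]
(`beta_one`).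

The induction differentiates asymptotic expansions, which big-O bounds alone do not permit. Error
terms are therefore kept in the class `Symbol`, where each derivative gains a power of x⁻¹;
`Symbol.logDeriv_expansion` and `Symbol.volterra_step` then carry an expansion from one index to the
next without loss of order.

The expansion of β_1 needs no Laplace method. Integration by parts gives linear recurrences between
the means of (u - c)^j, and positivity of means of nonnegative polynomials turns them into size
bounds. The derivatives of the means are again combinations of means, so the bounds upgrade to
symbol estimates (`rawMean_symbol`, `saddleMean_symbol`). Iterating the recurrence then produces the
expansion. For t → -∞ one takes c = 0 and s = -t; for t → +∞ one writes t = 3a² and centres at the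
saddle point c = a. -/

/-! ### Symbol classes: asymptotics stable under differentiation. -/

/-- `f = O(x ^ m)` at infinity, and each of its first `k` derivatives gains one more power of
`x⁻¹`. -/
def SymbolUpTo : ℕ → ℤ → (ℝ → ℝ) → Prop
  | 0, m, f => f =O[atTop] fun x : ℝ => x ^ m
  | k + 1, m, f => (f =O[atTop] fun x : ℝ => x ^ m) ∧
      ∃ f' : ℝ → ℝ, (∀ᶠ x in atTop, HasDerivAt f (f' x) x) ∧ SymbolUpTo k (m - 1) f'

/-- Symbols of order `m` at `+∞`. -/
def Symbol (m : ℤ) (f : ℝ → ℝ) : Prop := ∀ k, SymbolUpTo k m f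

theorem eventually_eventuallyEq_nhds {f g : ℝ → ℝ} (h : f =ᶠ[atTop] g) :
    ∀ᶠ x in atTop, f =ᶠ[nhds x] g := by
  obtain ⟨a, ha⟩ := eventually_atTop.1 h
  filter_upwards [eventually_gt_atTop a] with x hx
  filter_upwards [Ioi_mem_nhds hx] with y hy using ha y (le_of_lt hy)

theorem zpow_isBigO_zpow {m n : ℤ} (h : m ≤ n) :
    (fun x : ℝ => x ^ m) =O[atTop] fun x : ℝ => x ^ n := by
  refine IsBigO.of_bound 1 ?_
  filter_upwards [eventually_ge_atTop (1 : ℝ)] with x hx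
  have hx0 : 0 < x := by linarith
  rw [one_mul, Real.norm_of_nonneg (zpow_pos hx0 _).le, Real.norm_of_nonneg (zpow_pos hx0 _).le]
  exact zpow_le_zpow_right₀ hx h

theorem zpow_mul_zpow_eventuallyEq (m n : ℤ) :
    (fun x : ℝ => x ^ m * x ^ n) =ᶠ[atTop] fun x : ℝ => x ^ (m + n) := by
  filter_upwards [eventually_gt_atTop (0 : ℝ)] with x hx
  rw [zpow_add₀ hx.ne']

namespace SymbolUpTo

variable {k : ℕ} {m n : ℤ} {f g : ℝ → ℝ}

theorem isBigO (h : SymbolUpTo k m f) : f =O[atTop] fun x : ℝ => x ^ m := by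
  cases k with
  | zero => exact h
  | succ k => exact h.1

theorem congr (h : SymbolUpTo k m f) (hfg : f =ᶠ[atTop] g) : SymbolUpTo k m g := by
  cases k with
  | zero => exact IsBigO.congr' h hfg .rfl
  | succ k =>
    obtain ⟨h1, f', h2, h3⟩ := h
    refine ⟨h1.congr' hfg .rfl, f', ?_, h3⟩
    filter_upwards [h2, eventually_eventuallyEq_nhds hfg] with x hx hx'
    exact hx.congr_of_eventuallyEq hx'.symm

theorem mono (h : SymbolUpTo k m f) (hmn : m ≤ n) : SymbolUpTo k n f := by
  induction k generalizing m n f with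
  | zero => exact IsBigO.trans h (zpow_isBigO_zpow hmn)
  | succ k ih =>
    obtain ⟨h1, f', h2, h3⟩ := h
    exact ⟨h1.trans (zpow_isBigO_zpow hmn), f', h2, ih h3 (by omega)⟩

theorem of_succ (h : SymbolUpTo (k + 1) m f) : SymbolUpTo k m f := by
  induction k generalizing m f with
  | zero => exact h.1
  | succ k ih =>
    obtain ⟨h1, f', h2, h3⟩ := h
    exact ⟨h1, f', h2, ih h3⟩

theorem add (hf : SymbolUpTo k m f) (hg : SymbolUpTo k m g) :
    SymbolUpTo k m fun x => f x + g x := by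
  induction k generalizing m f g with
  | zero => exact IsBigO.add hf hg
  | succ k ih =>
    obtain ⟨h1, f', h2, h3⟩ := hf
    obtain ⟨i1, g', i2, i3⟩ := hg
    refine ⟨h1.add i1, fun x => f' x + g' x, ?_, ih h3 i3⟩
    filter_upwards [h2, i2] with x hx hx' using hx.add hx'

theorem mul (hf : SymbolUpTo k m f) (hg : SymbolUpTo k n g) :
    SymbolUpTo k (m + n) fun x => f x * g x := by
  induction k generalizing m n f g with
  | zero => exact (IsBigO.mul hf hg).congr' .rfl (zpow_mul_zpow_eventuallyEq m n)
  | succ k ih =>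
    have hf0 := hf.of_succ
    have hg0 := hg.of_succ
    obtain ⟨h1, f', h2, h3⟩ := hf
    obtain ⟨i1, g', i2, i3⟩ := hg
    refine ⟨(h1.mul i1).congr' .rfl (zpow_mul_zpow_eventuallyEq m n),
      fun x => f' x * g x + f x * g' x, ?_, ?_⟩
    · filter_upwards [h2, i2] with x hx hx' using hx.mul hx'
    · exact ((ih h3 hg0).mono (by omega)).add ((ih hf0 i3).mono (by omega))

theorem zpow (k : ℕ) (c : ℝ) (m : ℤ) : SymbolUpTo k m fun x => c * x ^ m := by
  induction k generalizing c m with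
  | zero => exact (isBigO_refl _ _).const_mul_left c
  | succ k ih =>
    refine ⟨(isBigO_refl _ _).const_mul_left c, fun x => (c * m) * x ^ (m - 1), ?_, ih _ _⟩
    filter_upwards [eventually_gt_atTop (0 : ℝ)] with x hx
    rw [mul_assoc]
    exact (hasDerivAt_zpow m x (Or.inl hx.ne')).const_mul c

theorem neg (hf : SymbolUpTo k m f) : SymbolUpTo k m fun x => -f x := by
  have h := (zpow k (-1) 0).mul hf
  rw [zero_add] at h
  simpa using h

/-- Induction through (1/f)' = -f' · (1/f)²; the lower bound on f is needed only for the size of 1/f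
itself. -/
theorem inv (hf : SymbolUpTo k m f) (hlow : (fun x : ℝ => x ^ m) =O[atTop] f) :
    SymbolUpTo k (-m) fun x => (f x)⁻¹ := by
  have hne : ∀ᶠ x in atTop, f x ≠ 0 := by
    obtain ⟨c, hc⟩ := hlow.bound
    filter_upwards [hc, eventually_gt_atTop (0 : ℝ)] with x hx hx0 h0
    rw [h0, norm_zero, mul_zero] at hx
    exact (norm_pos_iff.2 (zpow_pos hx0 m).ne').not_ge hx
  have hO : (fun x => (f x)⁻¹) =O[atTop] fun x : ℝ => x ^ (-m) := by
    simp only [zpow_neg]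
    refine hlow.inv_rev ?_
    filter_upwards [eventually_gt_atTop (0 : ℝ)] with x hx h0
    exact absurd h0 (zpow_pos hx m).ne'
  induction k with
  | zero => exact hO
  | succ k ih =>
    have hf0 := ih hf.of_succ
    obtain ⟨h1, f', h2, h3⟩ := hf
    refine ⟨hO, fun x => -(f' x * ((f x)⁻¹ * (f x)⁻¹)), ?_, ?_⟩
    · filter_upwards [h2, hne] with x hx hx0
      refine (hx.inv hx0).congr_deriv ?_
      rw [neg_div, div_eq_mul_inv, sq, mul_inv]
    · exact ((h3.mul (hf0.mul hf0)).mono (by omega)).neg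

end SymbolUpTo

namespace Symbol

variable {m n : ℤ} {f g : ℝ → ℝ}

theorem isBigO (h : Symbol m f) : f =O[atTop] fun x : ℝ => x ^ m := h 0

theorem congr (h : Symbol m f) (hfg : f =ᶠ[atTop] g) : Symbol m g := fun k => (h k).congr hfg

theorem mono (h : Symbol m f) (hmn : m ≤ n) : Symbol n f := fun k => (h k).mono hmn

theorem add (hf : Symbol m f) (hg : Symbol m g) : Symbol m fun x => f x + g x :=
  fun k => (hf k).add (hg k)

theorem neg (hf : Symbol m f) : Symbol m fun x => -f x := fun k => (hf k).neg

theorem sub (hf : Symbol m f) (hg : Symbol m g) : Symbol m fun x => f x - g x := by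
  simpa only [sub_eq_add_neg] using hf.add hg.neg

theorem mul (hf : Symbol m f) (hg : Symbol n g) : Symbol (m + n) fun x => f x * g x :=
  fun k => (hf k).mul (hg k)

theorem zpow (c : ℝ) (m : ℤ) : Symbol m fun x => c * x ^ m := fun k => .zpow k c m

theorem zpow_mul (hf : Symbol m f) (c : ℝ) (n : ℤ) : Symbol (n + m) fun x => c * x ^ n * f x :=
  (zpow c n).mul hf

theorem zpow_mul_of_le (hf : Symbol m f) (c : ℝ) (n : ℤ) {k : ℤ} (h : n + m ≤ k := by norm_num) :
    Symbol k fun x => c * x ^ n * f x :=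
  (hf.zpow_mul c n).mono h

theorem inv (hf : Symbol m f) (hlow : (fun x : ℝ => x ^ m) =O[atTop] f) :
    Symbol (-m) fun x => (f x)⁻¹ := fun k => (hf k).inv hlow

/-- Uniqueness of derivatives identifies g with the derivative hidden in the definition; this is
what allows an error term to be differentiated. -/
theorem of_hasDerivAt (hf : Symbol m f) (h : ∀ᶠ x in atTop, HasDerivAt f (g x) x) :
    Symbol (m - 1) g := by
  intro k
  obtain ⟨-, f', h2, h3⟩ := hf (k + 1)
  refine h3.congr ?_
  filter_upwards [h, h2] with x hx hx' using hx'.unique hx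

/-- The logarithmic derivative of a function with a two-term expansion. -/
theorem logDeriv_expansion {f' r : ℝ → ℝ} {p q : ℝ} (hp : p ≠ 0) (hr : Symbol (m - 6) r)
    (hf : ∀ᶠ x in atTop, f x = p * x ^ m + q * x ^ (m - 3) + r x)
    (hf' : ∀ᶠ x in atTop, HasDerivAt f (f' x) x) :
    Symbol (-7) fun x => f' x / f x - (m * x ^ (-1 : ℤ) - 3 * (q / p) * x ^ (-4 : ℤ)) := by
  have hfs : Symbol m f := by
    refine (((zpow p m).add ((zpow q (m - 3)).mono (by omega))).add
      (hr.mono (by omega))).congr ?_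
    filter_upwards [hf] with x hx using hx.symm
  have hrest : Symbol (m - 3) fun x => q * x ^ (m - 3) + r x :=
    (zpow q (m - 3)).add (hr.mono (by omega))
  have hlow : (fun x : ℝ => x ^ m) =O[atTop] f := by
    have h1 : (fun x => q * x ^ (m - 3) + r x) =o[atTop] fun x : ℝ => p * x ^ m := by
      refine (hrest.isBigO.trans_isLittleO ?_).trans_isBigO
        ((isBigO_refl (fun x : ℝ => x ^ m) atTop).const_mul_right' (isUnit_iff_ne_zero.2 hp))
      have h2 : (fun x : ℝ => x ^ m * x ^ (-3 : ℤ)) =o[atTop] fun x : ℝ => x ^ m * 1 :=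
        (isBigO_refl _ _).mul_isLittleO
          ((isLittleO_one_iff ℝ).2 (tendsto_zpow_atTop_zero (by norm_num)))
      simp only [mul_one] at h2
      exact h2.congr' (zpow_mul_zpow_eventuallyEq m (-3)) .rfl
    have h3 : f ~[atTop] fun x : ℝ => p * x ^ m := by
      refine h1.congr' ?_ .rfl
      filter_upwards [hf] with x hx
      simp only [Pi.sub_apply, hx]
      ring
    exact ((isBigO_refl (fun x : ℝ => x ^ m) atTop).const_mul_right'
      (isUnit_iff_ne_zero.2 hp)).trans h3.isBigO_symm
  have hne : ∀ᶠ x in atTop, f x ≠ 0 := by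
    obtain ⟨c, hc⟩ := hlow.bound
    filter_upwards [hc, eventually_gt_atTop (0 : ℝ)] with x hx hx0 h0
    rw [h0, norm_zero, mul_zero] at hx
    exact (norm_pos_iff.2 (zpow_pos hx0 m).ne').not_ge hx
  have hr' : Symbol (m - 7) fun x =>
      f' x - (p * (m * x ^ (m - 1)) + q * ((m - 3 : ℤ) * x ^ (m - 3 - 1))) := by
    refine (hr.of_hasDerivAt (g := fun x =>
      f' x - (p * (m * x ^ (m - 1)) + q * ((m - 3 : ℤ) * x ^ (m - 3 - 1)))) ?_).mono (by omega)
    filter_upwards [hf', eventually_eventuallyEq_nhds hf, eventually_gt_atTop (0 : ℝ)]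
      with x hx hx' hx0
    refine (hx.sub (((hasDerivAt_zpow m x (Or.inl hx0.ne')).const_mul p).add
      ((hasDerivAt_zpow (m - 3) x (Or.inl hx0.ne')).const_mul q))).congr_of_eventuallyEq ?_
    filter_upwards [hx'] with y hy
    simp [hy]
  have hT : Symbol (-1) fun x : ℝ => (m : ℝ) * x ^ (-1 : ℤ) - 3 * (q / p) * x ^ (-4 : ℤ) :=
    (zpow _ _).sub ((zpow _ _).mono (by norm_num))
  -- With T = m/x - 3(q/p)x⁻⁴, the terms of order m - 1 and m - 4 cancel in f' - T f, leaving
  -- (3q²/p) x^(m-7) + r' - T r, which is then divided by f.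
  have hnum := ((zpow (3 * q ^ 2 / p) (m - 7)).add hr').sub ((hT.mul hr).mono (n := m - 7) (by omega))
  refine ((hnum.mul (hfs.inv hlow)).mono (by omega)).congr ?_
  filter_upwards [hf, hne, eventually_gt_atTop (0 : ℝ)] with x hx hx0 hpos
  have hr1 : r x = f x - p * x ^ m - q * x ^ (m - 3) := by rw [hx]; ring
  rw [hr1, ← div_eq_mul_inv, div_eq_iff hx0, sub_mul (f' x / f x), div_mul_cancel₀ _ hx0]
  have e1 : x ^ (m - 7) = x ^ m * (x ^ 7)⁻¹ := zpow_sub₀ hpos.ne' m 7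
  have e2 : x ^ (m - 1) = x ^ m * x⁻¹ := by rw [zpow_sub₀ hpos.ne', zpow_one, div_eq_mul_inv]
  have e3 : x ^ (m - 3) = x ^ m * (x ^ 3)⁻¹ := zpow_sub₀ hpos.ne' m 3
  have e4 : x ^ (m - 3 - 1) = x ^ m * (x ^ 4)⁻¹ := by
    rw [show m - 3 - 1 = m - 4 by ring]; exact zpow_sub₀ hpos.ne' m 4
  have e5 : x ^ (-1 : ℤ) = x⁻¹ := zpow_neg_one x
  have e6 : x ^ (-4 : ℤ) = (x ^ 4)⁻¹ := zpow_neg x 4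
  rw [e1, e2, e3, e4, e5, e6]
  push_cast
  field_simp
  ring

end Symbol

/-! ### Moments: differentiation in t and integration by parts. -/

/-- The moment functional `p ↦ ∫ p(x) w(x) dx` of the sextic Freud weight. -/
def moment (lam t : ℝ) (p : ℝ[X]) : ℝ := ∫ x, p.eval x * weight lam t x

theorem pairing_eq_moment (lam t : ℝ) (p q : ℝ[X]) :
    pairing (weight lam t) p q = moment lam t (p * q) := by
  simp only [pairing, moment, eval_mul]

theorem weight_nonneg (lam t x : ℝ) : 0 ≤ weight lam t x :=
  mul_nonneg (Real.rpow_nonneg (abs_nonneg x) _) (Real.exp_pos _).le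

section Moment

variable {lam : ℝ}

theorem moment_add (hlam : -1 < lam) (t : ℝ) (p q : ℝ[X]) :
    moment lam t (p + q) = moment lam t p + moment lam t q := by
  rw [moment, moment, moment, ← integral_add (integrable_eval_mul_weight hlam t p)
    (integrable_eval_mul_weight hlam t q)]
  simp only [eval_add, add_mul]

theorem moment_smul (t c : ℝ) (p : ℝ[X]) : moment lam t (C c * p) = c * moment lam t p := by
  rw [moment, moment, ← integral_const_mul]
  simp only [eval_mul, eval_C, mul_assoc]

theorem moment_sum (hlam : -1 < lam) (t : ℝ) {ι : Type*} (s : Finset ι) (f : ι → ℝ[X]) :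
    moment lam t (∑ i ∈ s, f i) = ∑ i ∈ s, moment lam t (f i) := by
  simp only [moment, eval_finsetSum, Finset.sum_mul]
  exact integral_finsetSum _ fun i _ => integrable_eval_mul_weight hlam t (f i)

theorem moment_nonneg (t : ℝ) {p : ℝ[X]} (h : ∀ x, 0 ≤ p.eval x) : 0 ≤ moment lam t p :=
  integral_nonneg fun x => mul_nonneg (h x) (weight_nonneg lam t x)

theorem moment_one_pos (hlam : -1 < lam) (t : ℝ) : 0 < moment lam t 1 := by
  have h := pairing_weight_self_pos hlam t 1 one_ne_zero
  rwa [pairing_eq_moment, one_mul] at h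

/-- Differentiation under the integral brings down x². Since exp(s x²) increases with s, the
integrand at t + 1 dominates for every s < t + 1. -/
theorem hasDerivAt_moment (hlam : -1 < lam) (t : ℝ) (p : ℝ[X]) :
    HasDerivAt (fun t => moment lam t p) (moment lam t (X ^ 2 * p)) t := by
  have hmeas : ∀ (t : ℝ) (p : ℝ[X]),
      AEStronglyMeasurable (fun x => p.eval x * weight lam t x) volume := fun t p =>
    (integrable_eval_mul_weight hlam t p).aestronglyMeasurable
  refine (hasDerivAt_integral_of_dominated_loc_of_deriv_le
    (F := fun t x => p.eval x * weight lam t x)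
    (F' := fun t x => (X ^ 2 * p).eval x * weight lam t x)
    (bound := fun x => ‖(X ^ 2 * p).eval x * weight lam (t + 1) x‖)
    (Iio_mem_nhds (lt_add_one t)) (.of_forall fun t => hmeas t p)
    (integrable_eval_mul_weight hlam t p) (hmeas t _) (.of_forall fun x s hs => ?_)
    (integrable_eval_mul_weight hlam (t + 1) _).norm (.of_forall fun x s _ => ?_)).2
  · rw [norm_mul, norm_mul, Real.norm_of_nonneg (weight_nonneg _ _ _),
      Real.norm_of_nonneg (weight_nonneg _ _ _)]
    refine mul_le_mul_of_nonneg_left ?_ (norm_nonneg _)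
    refine mul_le_mul_of_nonneg_left (Real.exp_le_exp.2 ?_) (Real.rpow_nonneg (abs_nonneg x) _)
    have := mul_le_mul_of_nonneg_right (Set.mem_Iio.1 hs).le (sq_nonneg x)
    linarith
  · have h1 : HasDerivAt (fun s : ℝ => -x ^ 6 + s * x ^ 2) (1 * x ^ 2) s :=
      ((hasDerivAt_id s).mul_const (x ^ 2)).const_add _
    refine ((h1.exp.const_mul (|x| ^ (2 * lam + 1))).const_mul (p.eval x)).congr_deriv ?_
    simp only [weight, eval_mul, eval_pow, eval_X]
    ring

/-- Integration by parts against an even polynomial. -/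
theorem moment_integration_by_parts (hlam : -1 < lam) (t : ℝ) (p : ℝ[X])
    (hp : ∀ x, p.eval (-x) = p.eval x) :
    moment lam t (C (2 * lam + 2) * p + X * derivative p
      + (C (2 * t) * X ^ 2 - C 6 * X ^ 6) * p) = 0 := by
  set q := C (2 * lam + 2) * p + X * derivative p + (C (2 * t) * X ^ 2 - C 6 * X ^ 6) * p with hq
  have hp' : ∀ x, (derivative p).eval (-x) = -(derivative p).eval x := by
    intro x
    have h : p.comp (-X) = p := Polynomial.funext fun x => by simp [hp]
    have h2 := congrArg (fun r => (derivative r).eval x) h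
    simp only [derivative_comp, eval_mul, eval_comp, derivative_neg, derivative_X, eval_neg,
      eval_one, eval_X] at h2
    linarith
  have hqe : ∀ x, q.eval (-x) = q.eval x := by
    intro x
    simp only [hq, eval_add, eval_mul, eval_sub, eval_C, eval_X, eval_pow, hp, hp']
    ring
  have habs : moment lam t q
      = ∫ x, (fun y => q.eval y * weight lam t y) |x| := by
    refine integral_congr_ae (.of_forall fun x => ?_)
    rcases abs_choice x with h | h <;> simp only [h, hqe, weight_neg]
  rw [habs, integral_comp_abs (f := fun y => q.eval y * weight lam t y)]
  -- On x > 0, raising λ by 1/2 multiplies the weight by x, so the antiderivative is p(x) x^(2λ+2)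
  -- exp(-x⁶ + tx²). It vanishes at 0 because 2λ + 2 > 0, and at infinity because it and its
  -- derivative are integrable.
  have hpos : -1 < lam + 1 / 2 := by linarith
  have hderiv : ∀ x ∈ Set.Ioi (0 : ℝ), HasDerivAt
      (fun x => p.eval x * weight (lam + 1 / 2) t x) (q.eval x * weight lam t x) x := by
    intro x hx
    have hx0 : 0 < x := hx
    have h1 : HasDerivAt (fun x : ℝ => x ^ (2 * lam + 2))
        ((2 * lam + 2) * x ^ (2 * lam + 2 - 1)) x :=
      Real.hasDerivAt_rpow_const (Or.inl hx0.ne')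
    have h2 : HasDerivAt (fun x : ℝ => -x ^ 6 + t * x ^ 2)
        (-(((6 : ℕ) : ℝ) * x ^ (6 - 1)) + t * (((2 : ℕ) : ℝ) * x ^ (2 - 1))) x :=
      (hasDerivAt_pow 6 x).neg.add ((hasDerivAt_pow 2 x).const_mul t)
    refine (((p.hasDerivAt x).mul (h1.mul h2.exp)).congr_of_eventuallyEq ?_).congr_deriv ?_
    · filter_upwards [Ioi_mem_nhds hx0] with y hy
      have hy0 : 0 < y := hy
      simp only [weight, abs_of_pos hy0, Pi.mul_apply]
      rw [show 2 * (lam + 1 / 2) + 1 = 2 * lam + 2 by ring]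
    · have e1 : x ^ (2 * lam + 2) = x ^ (2 * lam + 1) * x := by
        rw [← Real.rpow_add_one hx0.ne']; ring_nf
      simp only [hq, weight, Pi.mul_apply, abs_of_pos hx0, eval_add, eval_mul, eval_sub, eval_C, eval_X,
        eval_pow, e1, show 2 * lam + 2 - 1 = 2 * lam + 1 by ring]
      push_cast
      ring
  have hint := (integrable_eval_mul_weight hlam t q).integrableOn (s := Set.Ioi 0)
  have hint' := (integrable_eval_mul_weight hpos t p).integrableOn (s := Set.Ioi 0)
  rw [integral_Ioi_of_hasDerivAt_of_tendsto ?_ hderiv hint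
    (tendsto_zero_of_hasDerivAt_of_integrableOn_Ioi hderiv hint hint')]
  · have : 2 * (lam + 1 / 2) + 1 ≠ 0 := by linarith
    simp only [weight, abs_zero, Real.zero_rpow this, zero_mul, mul_zero, sub_zero]
  · refine (p.continuous.mul ?_).continuousWithinAt
    refine (continuous_abs.rpow_const fun x => Or.inr (by linarith)).mul ?_
    fun_prop

end Moment

/-! ### Polynomials depending differentiably on a parameter. -/

/-- The coefficients of `P` are differentiable at `s`, with derivatives the coefficients of `P'`,
and the degrees are bounded. -/
def HasPolyDerivAt (P : ℝ → ℝ[X]) (P' : ℝ[X]) (s : ℝ) : Prop :=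
  ∃ N : ℕ, (∀ u, (P u).natDegree < N) ∧ P'.natDegree < N ∧
    ∀ i, HasDerivAt (fun u => (P u).coeff i) (P'.coeff i) s

namespace HasPolyDerivAt

variable {P Q : ℝ → ℝ[X]} {P' Q' : ℝ[X]} {s : ℝ}

theorem const (p : ℝ[X]) (s : ℝ) : HasPolyDerivAt (fun _ => p) 0 s :=
  ⟨p.natDegree + 1, fun _ => Nat.lt_succ_self _, by simp, fun i => by
    simpa using hasDerivAt_const s (p.coeff i)⟩

theorem C_of_hasDerivAt {f : ℝ → ℝ} {f' : ℝ} (hf : HasDerivAt f f' s) :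
    HasPolyDerivAt (fun u => C (f u)) (C f') s := by
  refine ⟨1, by simp, by simp, fun i => ?_⟩
  rcases eq_or_ne i 0 with rfl | hi
  · simpa using hf
  · simpa [coeff_C, hi] using hasDerivAt_const s (0 : ℝ)

theorem sub (hP : HasPolyDerivAt P P' s) (hQ : HasPolyDerivAt Q Q' s) :
    HasPolyDerivAt (fun u => P u - Q u) (P' - Q') s := by
  obtain ⟨N, h1, h2, h3⟩ := hP
  obtain ⟨M, i1, i2, i3⟩ := hQ
  refine ⟨max N M, fun u => ?_, ?_, fun i => ?_⟩
  · exact (natDegree_sub_le _ _).trans_lt (max_lt_max (h1 u) (i1 u))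
  · exact (natDegree_sub_le _ _).trans_lt (max_lt_max h2 i2)
  · simpa only [coeff_sub] using (h3 i).fun_sub (i3 i)

theorem add (hP : HasPolyDerivAt P P' s) (hQ : HasPolyDerivAt Q Q' s) :
    HasPolyDerivAt (fun u => P u + Q u) (P' + Q') s := by
  simpa using hP.sub ((const 0 s).sub hQ)

theorem mul (hP : HasPolyDerivAt P P' s) (hQ : HasPolyDerivAt Q Q' s) :
    HasPolyDerivAt (fun u => P u * Q u) (P' * Q s + P s * Q') s := by
  obtain ⟨N, h1, h2, h3⟩ := hP
  obtain ⟨M, i1, i2, i3⟩ := hQ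
  refine ⟨N + M, fun u => ?_, ?_, fun i => ?_⟩
  · exact natDegree_mul_le.trans_lt (add_lt_add (h1 u) (i1 u))
  · refine (natDegree_add_le _ _).trans_lt (max_lt ?_ ?_)
    · exact natDegree_mul_le.trans_lt (add_lt_add h2 (i1 s))
    · exact natDegree_mul_le.trans_lt (add_lt_add (h1 s) i2)
  · simp only [coeff_add, coeff_mul, ← Finset.sum_add_distrib]
    exact HasDerivAt.fun_sum fun j _ => (h3 j.1).mul (i3 j.2)

theorem pow (hP : HasPolyDerivAt P P' s) (j : ℕ) :
    HasPolyDerivAt (fun u => P u ^ j) (C (j : ℝ) * P s ^ (j - 1) * P') s := by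
  induction j with
  | zero => simpa using const 1 s
  | succ j ih =>
    have h := ih.mul hP
    simp only [← pow_succ] at h
    convert h using 1
    rcases j with - | j
    · simp
    · simp only [Nat.add_sub_cancel, pow_succ, Nat.cast_add, Nat.cast_one, C_add, C_1]
      ring

theorem sum {ι : Type*} (t : Finset ι) {P : ι → ℝ → ℝ[X]} {P' : ι → ℝ[X]}
    (h : ∀ i, HasPolyDerivAt (P i) (P' i) s) :
    HasPolyDerivAt (fun u => ∑ i ∈ t, P i u) (∑ i ∈ t, P' i) s := by
  classical
  induction t using Finset.induction_on with
  | empty => simpa using const 0 s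
  | insert a t ha ih =>
    simp only [Finset.sum_insert ha]
    exact (h a).add ih

/-- The uniform degree bound makes the moment a finite sum of coefficients times moments of
monomials, with a range independent of u, so the product rule applies termwise. -/
theorem moment {lam : ℝ} (hlam : -1 < lam) {τ : ℝ → ℝ} {τ' : ℝ} (hτ : HasDerivAt τ τ' s)
    (hP : HasPolyDerivAt P P' s) :
    HasDerivAt (fun u => moment lam (τ u) (P u))
      (moment lam (τ s) P' + τ' * SexticFreud.moment lam (τ s) (X ^ 2 * P s)) s := by
  obtain ⟨N, h1, h2, h3⟩ := hP
  have hexp : ∀ (t : ℝ) (p q : ℝ[X]), p.natDegree < N → SexticFreud.moment lam t (q * p)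
      = ∑ i ∈ Finset.range N, p.coeff i * SexticFreud.moment lam t (q * X ^ i) := by
    intro t p q hp
    conv_lhs => rw [as_sum_range_C_mul_X_pow' p hp, Finset.mul_sum, moment_sum hlam]
    refine Finset.sum_congr rfl fun i _ => ?_
    rw [← moment_smul]
    ring_nf
  have hexp1 : ∀ (t : ℝ) (p : ℝ[X]), p.natDegree < N → SexticFreud.moment lam t p
      = ∑ i ∈ Finset.range N, p.coeff i * SexticFreud.moment lam t (X ^ i) := by
    intro t p hp
    simpa using hexp t p 1 hp
  have h : HasDerivAt
      (fun u => ∑ i ∈ Finset.range N, (P u).coeff i * SexticFreud.moment lam (τ u) (X ^ i))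
      (∑ i ∈ Finset.range N, (P'.coeff i * SexticFreud.moment lam (τ s) (X ^ i)
        + (P s).coeff i * (SexticFreud.moment lam (τ s) (X ^ 2 * X ^ i) * τ'))) s :=
    HasDerivAt.fun_sum fun i _ => (h3 i).mul ((hasDerivAt_moment hlam (τ s) (X ^ i)).comp s hτ)
  refine (h.congr_of_eventuallyEq (.of_forall fun u => hexp1 _ _ (h1 u))).congr_deriv ?_
  rw [hexp1 _ _ h2, hexp _ _ _ (h1 s), Finset.mul_sum, ← Finset.sum_add_distrib]
  exact Finset.sum_congr rfl fun i _ => by ring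

end HasPolyDerivAt

/-! ### The Volterra lattice for the recurrence coefficients. -/

section Volterra

variable {lam : ℝ}

/-- Differentiability passes through the Gram–Schmidt recursion, whose denominators are positive.
Only existence matters: later the derivative enters solely through its degree. -/
theorem exists_hasPolyDerivAt_monicOP (hlam : -1 < lam) (n : ℕ) (t : ℝ) :
    ∃ P', HasPolyDerivAt (fun u => monicOP (weight lam u) n) P' t := by
  induction n using Nat.strong_induction_on with
  | _ n ih =>
    choose P' hP' using fun k : Fin n => ih k k.2
    have hpair : ∀ {P Q : ℝ → ℝ[X]} {P' Q' : ℝ[X]}, HasPolyDerivAt P P' t →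
        HasPolyDerivAt Q Q' t →
        ∃ d, HasDerivAt (fun u => pairing (weight lam u) (P u) (Q u)) d t := by
      intro P Q P' Q' hP hQ
      simp only [pairing_eq_moment]
      exact ⟨_, (hP.mul hQ).moment hlam (hasDerivAt_id t)⟩
    have hterm : ∀ k : Fin n, ∃ R, HasPolyDerivAt (fun u =>
        C (pairing (weight lam u) (X ^ n) (monicOP (weight lam u) k) /
          pairing (weight lam u) (monicOP (weight lam u) k) (monicOP (weight lam u) k))
            * monicOP (weight lam u) k) R t := by
      intro k
      obtain ⟨d1, hd1⟩ := hpair (.const (X ^ n) t) (hP' k)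
      obtain ⟨d2, hd2⟩ := hpair (hP' k) (hP' k)
      exact ⟨_, (HasPolyDerivAt.C_of_hasDerivAt (hd1.div hd2 (pairing_weight_self_pos hlam t _
        (monicOP_monic_degree _ _).1.ne_zero).ne')).mul (hP' k)⟩
    choose R hR using hterm
    have heq : (fun u => monicOP (weight lam u) n) = fun u => X ^ n - ∑ k : Fin n,
        C (pairing (weight lam u) (X ^ n) (monicOP (weight lam u) k) /
          pairing (weight lam u) (monicOP (weight lam u) k) (monicOP (weight lam u) k))
            * monicOP (weight lam u) k := _root_.funext fun u => by rw [monicOP]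
    rw [heq]
    exact ⟨_, (HasPolyDerivAt.const (X ^ n) t).sub (.sum _ hR)⟩

theorem normConst_pos (hlam : -1 < lam) (t : ℝ) (n : ℕ) : 0 < normConst (weight lam t) n :=
  pairing_weight_self_pos hlam t _ (monicOP_monic_degree _ _).1.ne_zero

theorem pairing_monicOP_of_degree_lt (hlam : -1 < lam) (t : ℝ) (n : ℕ) (q : ℝ[X])
    (hq : q.degree < n) : pairing (weight lam t) q (monicOP (weight lam t) n) = 0 :=
  pairing_eq_zero_of_degree_lt (integrable_eval_mul_weight hlam t) _ n (fun k hk => by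
    rw [monicOP_orthogonal hlam, if_neg hk.ne]) q hq

theorem monicOP_zero (w : ℝ → ℝ) : monicOP w 0 = 1 := by
  rw [monicOP]
  simp

theorem pairing_monic_monicOP (hlam : -1 < lam) (t : ℝ) (n : ℕ) (q : ℝ[X]) (hq : q.Monic)
    (hd : q.degree = n) :
    pairing (weight lam t) q (monicOP (weight lam t) n) = normConst (weight lam t) n := by
  have hP := monicOP_monic_degree (weight lam t) n
  have h := pairing_monicOP_of_degree_lt hlam t n (q - monicOP (weight lam t) n) (by
    have := degree_sub_lt_left (hd.trans hP.2.symm) hq.ne_zero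
      (by rw [hq.leadingCoeff, hP.1.leadingCoeff])
    rwa [hd] at this)
  rw [pairing_sub_left (integrable_eval_mul_weight hlam t)] at h
  rw [normConst]
  linarith

theorem beta_zero (t : ℝ) : beta lam 0 t = 0 := rfl

theorem beta_succ (hlam : -1 < lam) (t : ℝ) (n : ℕ) : beta lam (n + 1) t
    = normConst (weight lam t) (n + 1) / normConst (weight lam t) n := by
  have hP := monicOP_monic_degree (weight lam t) n
  rw [beta, recCoeff, pairing_monic_monicOP hlam t (n + 1) _ (monic_X.mul hP.1)
    (by rw [degree_mul, degree_X, hP.2]; push_cast; ring)]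

theorem beta_succ_pos (hlam : -1 < lam) (t : ℝ) (n : ℕ) : 0 < beta lam (n + 1) t := by
  rw [beta_succ hlam]
  exact div_pos (normConst_pos hlam t _) (normConst_pos hlam t _)

theorem monicOP_one (hlam : -1 < lam) (t : ℝ) : monicOP (weight lam t) 1 = X := by
  have hP := monicOP_monic_degree (weight lam t) 1
  have h := monicOP_comp_neg (integrable_eval_mul_weight hlam t) (pairing_weight_self_pos hlam t)
    (weight_neg lam t) 1
  have h0 := congrArg (fun p => coeff p 0) h
  simp only [coeff_C_mul, coeff_comp_neg_X_aux] at h0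
  have hnat : (monicOP (weight lam t) 1).natDegree ≤ 1 := natDegree_le_of_degree_le hP.2.le
  have h1 : (monicOP (weight lam t) 1).coeff 1 = 1 := by
    have := hP.1.coeff_natDegree
    rwa [natDegree_eq_of_degree_eq_some hP.2] at this
  rw [eq_X_add_C_of_natDegree_le_one hnat, h1, show (monicOP (weight lam t) 1).coeff 0 = 0 by
    linarith]
  simp

/-- Expand x P_n = P_{n+1} + β_n P_{n-1}, use orthogonality, and write the norms as ratios h_{n+1} =
β_{n+1} h_n, h_n = β_n h_{n-1}. -/
theorem pairing_X_mul_self (hlam : -1 < lam) (t : ℝ) (n : ℕ) :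
    pairing (weight lam t) (X * monicOP (weight lam t) n) (X * monicOP (weight lam t) n)
      = normConst (weight lam t) n * (beta lam n t + beta lam (n + 1) t) := by
  rcases n with - | n
  · rw [beta_zero, zero_add, beta_succ hlam, mul_div_cancel₀ _ (normConst_pos hlam t 0).ne',
      monicOP_zero, mul_one, normConst, monicOP_one hlam]
  · have hX : X * monicOP (weight lam t) (n + 1) = monicOP (weight lam t) (n + 2)
        + C (beta lam (n + 1) t) * monicOP (weight lam t) n := by
      rw [monicOP_recurrence hlam]; ring
    have hint := integrable_eval_mul_weight hlam t
    have hb := beta_succ hlam t n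
    have hb' := beta_succ hlam t (n + 1)
    have h0 := (normConst_pos hlam t n).ne'
    have h1 := (normConst_pos hlam t (n + 1)).ne'
    rw [hX, pairing_add_left hint, pairing_C_mul_left, pairing_comm _ (monicOP _ (n + 2)),
      pairing_comm _ (monicOP _ n), pairing_add_left hint, pairing_add_left hint,
      pairing_C_mul_left, pairing_C_mul_left, monicOP_orthogonal hlam, monicOP_orthogonal hlam,
      monicOP_orthogonal hlam, monicOP_orthogonal hlam, if_pos rfl, if_pos rfl,
      if_neg (by omega), if_neg (by omega)]
    rw [hb', hb]
    field_simp
    ring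

/-- P_n is monic for every t, so its t-derivative has degree below n and is orthogonal to P_n. Only
the derivative of the weight contributes, namely the squared norm of x P_n. -/
theorem hasDerivAt_normConst (hlam : -1 < lam) (n : ℕ) (t : ℝ) :
    HasDerivAt (fun t => normConst (weight lam t) n)
      (normConst (weight lam t) n * (beta lam n t + beta lam (n + 1) t)) t := by
  obtain ⟨P', hP'⟩ := exists_hasPolyDerivAt_monicOP hlam n t
  have hdeg : P'.degree < n := by
    obtain ⟨-, -, -, h⟩ := hP'
    rw [degree_lt_iff_coeff_zero]
    intro m hm
    refine (h m).unique ?_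
    have hc : ∀ u, (monicOP (weight lam u) n).coeff m = if m = n then 1 else 0 := by
      intro u
      have hP := monicOP_monic_degree (weight lam u) n
      have hnat : (monicOP (weight lam u) n).natDegree = n := natDegree_eq_of_degree_eq_some hP.2
      split_ifs with h
      · have := hP.1.coeff_natDegree
        subst h
        rwa [hnat] at this
      · exact coeff_eq_zero_of_natDegree_lt (by omega)
    simp only [hc]
    exact hasDerivAt_const _ _
  have h := (hP'.mul hP').moment hlam (hasDerivAt_id t)
  simp only [normConst, pairing_eq_moment]
  refine h.congr_deriv ?_
  have h0 := pairing_monicOP_of_degree_lt hlam t n P' hdeg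
  have h1 := pairing_X_mul_self hlam t n
  rw [pairing_eq_moment] at h0 h1
  rw [normConst, pairing_eq_moment] at h1
  rw [moment_add hlam, mul_comm _ P']
  simp only [id]
  rw [h0, ← h1]
  ring_nf

/-- The Volterra lattice equation. -/
theorem hasDerivAt_beta (hlam : -1 < lam) (n : ℕ) (t : ℝ) :
    HasDerivAt (beta lam (n + 1))
      (beta lam (n + 1) t * (beta lam (n + 2) t - beta lam n t)) t := by
  have h := (hasDerivAt_normConst hlam (n + 1) t).div (hasDerivAt_normConst hlam n t)
    (normConst_pos hlam t n).ne'
  refine (h.congr_of_eventuallyEq (.of_forall fun u => beta_succ hlam u n)).congr_deriv ?_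
  have hh := (normConst_pos hlam t n).ne'
  rw [beta_succ hlam t n]
  field_simp
  ring

theorem beta_one (hlam : -1 < lam) (t : ℝ) :
    beta lam 1 t = moment lam t (X ^ 2) / moment lam t 1 := by
  rw [beta_succ hlam, normConst, normConst, zero_add, monicOP_one hlam, monicOP_zero,
    pairing_eq_moment, pairing_eq_moment, one_mul, sq]

end Volterra

/-! ### Centred means: recurrence, derivative and positivity. -/

/-- The moments of `x² - c`. -/
def centredMoment (lam c t : ℝ) (j : ℕ) : ℝ := moment lam t ((X ^ 2 - C c) ^ j)

/-- The moments of `x² - c` under the normalised weight. -/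
def centredMean (lam c t : ℝ) (j : ℕ) : ℝ := centredMoment lam c t j / centredMoment lam c t 0

section CentredMean

variable {lam : ℝ}

theorem centredMoment_zero_pos (hlam : -1 < lam) (c t : ℝ) : 0 < centredMoment lam c t 0 := by
  simpa [centredMoment] using moment_one_pos hlam t

theorem centredMean_zero (hlam : -1 < lam) (c t : ℝ) : centredMean lam c t 0 = 1 :=
  div_self (centredMoment_zero_pos hlam c t).ne'

theorem moment_X_sq_mul (hlam : -1 < lam) (c t : ℝ) (j : ℕ) :
    moment lam t (X ^ 2 * (X ^ 2 - C c) ^ j)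
      = centredMoment lam c t (j + 1) + c * centredMoment lam c t j := by
  rw [centredMoment, centredMoment, ← moment_smul, ← moment_add hlam]
  ring_nf

theorem beta_one_eq (hlam : -1 < lam) (c t : ℝ) :
    beta lam 1 t = c + centredMean lam c t 1 := by
  have h := moment_X_sq_mul hlam c t 0
  have h0 := (centredMoment_zero_pos hlam c t).ne'
  rw [pow_zero, mul_one] at h
  rw [beta_one hlam, h, centredMean, show moment lam t 1 = centredMoment lam c t 0 by
    simp [centredMoment]]
  field_simp
  ring

/-- Integration by parts with p = (x² - c)^j, re-expanding x² about c. For j = 0 the truncated index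
j - 1 is harmless, being multiplied by j. -/
theorem centredMoment_recurrence (hlam : -1 < lam) (c t : ℝ) (j : ℕ) :
    (lam + 1 + j) * centredMoment lam c t j + j * c * centredMoment lam c t (j - 1)
      + t * (centredMoment lam c t (j + 1) + c * centredMoment lam c t j)
      = 3 * (centredMoment lam c t (j + 3) + 3 * c * centredMoment lam c t (j + 2)
        + 3 * c ^ 2 * centredMoment lam c t (j + 1) + c ^ 3 * centredMoment lam c t j) := by
  have h := moment_integration_by_parts hlam t ((X ^ 2 - C c) ^ j) (fun x => by simp)
  have hd : X * derivative ((X ^ 2 - C c) ^ j)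
      = C (2 * j : ℝ) * ((X ^ 2 - C c) ^ j) + C (2 * j * c) * (X ^ 2 - C c) ^ (j - 1) := by
    rcases j with - | j
    · simp
    · simp only [derivative_pow_succ, derivative_sub, derivative_X, derivative_C,
        Nat.add_sub_cancel, map_mul, map_add, map_natCast, map_one, map_ofNat]
      push_cast
      ring
  have hexp : C (2 * lam + 2) * (X ^ 2 - C c) ^ j + X * derivative ((X ^ 2 - C c) ^ j)
      + (C (2 * t) * X ^ 2 - C 6 * X ^ 6) * (X ^ 2 - C c) ^ j
      = C (2 * lam + 2 + 2 * j + 2 * t * c - 6 * c ^ 3) * (X ^ 2 - C c) ^ j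
        + C (2 * j * c) * (X ^ 2 - C c) ^ (j - 1)
        + C (2 * t - 18 * c ^ 2) * (X ^ 2 - C c) ^ (j + 1)
        + C (-18 * c) * (X ^ 2 - C c) ^ (j + 2) + C (-6) * (X ^ 2 - C c) ^ (j + 3) := by
    rw [hd]
    simp only [map_mul, map_add, map_sub, map_pow, map_neg, map_natCast, map_ofNat]
    ring
  rw [hexp] at h
  simp only [moment_add hlam, moment_smul] at h
  simp only [centredMoment]
  linarith

theorem centredMean_recurrence (hlam : -1 < lam) (c t : ℝ) (j : ℕ) :
    (lam + 1 + j) * centredMean lam c t j + j * c * centredMean lam c t (j - 1)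
      + t * (centredMean lam c t (j + 1) + c * centredMean lam c t j)
      = 3 * (centredMean lam c t (j + 3) + 3 * c * centredMean lam c t (j + 2)
        + 3 * c ^ 2 * centredMean lam c t (j + 1) + c ^ 3 * centredMean lam c t j) := by
  have h := centredMoment_recurrence hlam c t j
  have h0 := (centredMoment_zero_pos hlam c t).ne'
  simp only [centredMean]
  field_simp
  linarith

/-- The centre and the parameter may move together, as they do on t = 3a², c = a. Normalising
cancels the term proportional to c in the derivative of each moment. -/
theorem hasDerivAt_centredMean (hlam : -1 < lam) {c τ : ℝ → ℝ} {c' τ' s : ℝ}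
    (hc : HasDerivAt c c' s) (hτ : HasDerivAt τ τ' s) (j : ℕ) :
    HasDerivAt (fun u => centredMean lam (c u) (τ u) j)
      (τ' * (centredMean lam (c s) (τ s) (j + 1)
          - centredMean lam (c s) (τ s) j * centredMean lam (c s) (τ s) 1)
        - j * c' * centredMean lam (c s) (τ s) (j - 1)) s := by
  have key : ∀ j : ℕ, HasDerivAt (fun u => centredMoment lam (c u) (τ u) j)
      (τ' * (centredMoment lam (c s) (τ s) (j + 1) + c s * centredMoment lam (c s) (τ s) j)
        - j * c' * centredMoment lam (c s) (τ s) (j - 1)) s := by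
    intro j
    refine ((((HasPolyDerivAt.const (X ^ 2) s).sub
      (HasPolyDerivAt.C_of_hasDerivAt hc)).pow j).moment hlam hτ).congr_deriv ?_
    rw [moment_X_sq_mul hlam, show C (j : ℝ) * (X ^ 2 - C (c s)) ^ (j - 1) * (0 - C c')
      = C (-(j * c')) * (X ^ 2 - C (c s)) ^ (j - 1) by
        simp only [map_mul, map_neg]; ring, moment_smul]
    simp only [centredMoment]
    ring
  have h0 := (centredMoment_zero_pos hlam (c s) (τ s)).ne'
  refine ((key j).div (key 0) h0).congr_deriv ?_
  simp only [centredMean, zero_add, Nat.cast_zero]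
  field_simp
  ring

/-- The single source of inequalities between means: a pointwise nonnegative polynomial has a
nonnegative mean. -/
theorem centredMean_nonneg_of {c t : ℝ} (hlam : -1 < lam) (p : ℝ[X]) (r : ℝ)
    (hp : ∀ x, 0 ≤ p.eval x) (h : moment lam t p = r * centredMoment lam c t 0) : 0 ≤ r := by
  have h1 := moment_nonneg (lam := lam) t hp
  rw [h] at h1
  exact nonneg_of_mul_nonneg_left h1 (centredMoment_zero_pos hlam c t)

theorem centredMean_mul (hlam : -1 < lam) (c t : ℝ) (j : ℕ) :
    centredMean lam c t j * centredMoment lam c t 0 = moment lam t ((X ^ 2 - C c) ^ j) :=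
  div_mul_cancel₀ _ (centredMoment_zero_pos hlam c t).ne'

end CentredMean

/-- One lattice step in a general variable: κ x^l is the reciprocal of dt/dx. It is used with κ =
-1, l = 0 for t = -s, and with κ = 1/6, l = -1 for t = 3a². -/
theorem Symbol.volterra_step {m l : ℤ} {b₀ b₁ b₂ b₁' r : ℝ → ℝ} {p q κ : ℝ} (hp : p ≠ 0)
    (hr : Symbol (m - 6) r)
    (hb : ∀ᶠ x in atTop, b₁ x = p * x ^ m + q * x ^ (m - 3) + r x)
    (hb' : ∀ᶠ x in atTop, HasDerivAt b₁ (b₁' x) x)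
    (hstep : ∀ᶠ x in atTop, b₂ x = b₀ x + κ * x ^ l * (b₁' x / b₁ x)) :
    Symbol (l - 7) fun x =>
      b₂ x - b₀ x - (κ * m * x ^ (l - 1) - 3 * κ * (q / p) * x ^ (l - 4)) := by
  refine (((logDeriv_expansion hp hr hb hb').zpow_mul κ l).mono (n := l - 7) (by omega)).congr ?_
  filter_upwards [hstep, eventually_gt_atTop (0 : ℝ)] with x hx hpos
  rw [hx, sub_eq_add_neg l 1, sub_eq_add_neg l 4, zpow_add₀ hpos.ne', zpow_add₀ hpos.ne']
  ring

/-! ### The limit t → -∞. -/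

section AtBot

variable {lam : ℝ}

theorem rawMean_recurrence (hlam : -1 < lam) (s : ℝ) (k : ℕ) :
    s * centredMean lam 0 (-s) (k + 1)
      = (lam + 1 + k) * centredMean lam 0 (-s) k - 3 * centredMean lam 0 (-s) (k + 3) := by
  have := centredMean_recurrence hlam 0 (-s) k
  simp only [mul_zero, zero_mul, add_zero] at this
  linarith [this]

theorem rawMean_nonneg (hlam : -1 < lam) (t : ℝ) (k : ℕ) : 0 ≤ centredMean lam 0 t k := by
  refine centredMean_nonneg_of hlam _ _ (fun x => ?_) (centredMean_mul hlam 0 t k).symm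
  simp only [eval_pow, eval_sub, eval_X, eval_C, sub_zero]
  positivity

/-- All means of powers of x² are nonnegative, so dropping the negative term of the recurrence gives
s E[u^(k+1)] ≤ (λ + 1 + k) E[u^k]. -/
theorem rawMean_isBigO (hlam : -1 < lam) (k : ℕ) :
    (fun s => centredMean lam 0 (-s) k) =O[atTop] fun s : ℝ => s ^ (-(k : ℤ)) := by
  induction k with
  | zero => simpa [centredMean_zero hlam] using isBigO_refl (fun _ : ℝ => (1 : ℝ)) atTop
  | succ k ih =>
    have h : SymbolUpTo 0 (-(k : ℤ)) fun s => centredMean lam 0 (-s) k := ih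
    refine IsBigO.trans ?_ (((SymbolUpTo.zpow 0 1 (-1)).mul h).mono
      (n := -((k + 1 : ℕ) : ℤ)) (by push_cast; omega)).isBigO
    refine IsBigO.of_bound (lam + 1 + k) ?_
    filter_upwards [eventually_gt_atTop (0 : ℝ)] with s hs
    have hrec := rawMean_recurrence hlam s k
    have h1 := rawMean_nonneg hlam (-s) k
    have h2 := rawMean_nonneg hlam (-s) (k + 1)
    have h3 := rawMean_nonneg hlam (-s) (k + 3)
    rw [zpow_neg_one, Real.norm_of_nonneg h2, Real.norm_of_nonneg (by positivity), one_mul,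
      ← mul_assoc, mul_comm _ s⁻¹, mul_assoc, inv_mul_eq_div, le_div_iff₀ hs]
    linarith

theorem rawMean_hasDerivAt (hlam : -1 < lam) {s : ℝ} (hs : 0 < s) (k : ℕ) :
    HasDerivAt (fun s => centredMean lam 0 (-s) k)
      (-(lam + 1 + k) * s ^ (-1 : ℤ) * centredMean lam 0 (-s) k
        + 3 * s ^ (-1 : ℤ) * centredMean lam 0 (-s) (k + 3)
        + centredMean lam 0 (-s) k
          * ((lam + 1) * s ^ (-1 : ℤ) + -3 * s ^ (-1 : ℤ) * centredMean lam 0 (-s) 3)) s := by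
  refine (hasDerivAt_centredMean hlam (hasDerivAt_const s 0) (hasDerivAt_neg s) k).congr_deriv ?_
  have h1 := rawMean_recurrence hlam s k
  have h2 := rawMean_recurrence hlam s 0
  rw [centredMean_zero hlam] at h2
  simp only [zero_add, Nat.cast_zero, add_zero] at h2
  rw [zpow_neg_one]
  field_simp
  linear_combination (-1) * h1 + centredMean lam 0 (-s) k * h2

theorem rawMean_symbol (hlam : -1 < lam) (k : ℕ) :
    Symbol (-(k : ℤ)) fun s => centredMean lam 0 (-s) k := by
  intro N
  induction N generalizing k with
  | zero => exact rawMean_isBigO hlam k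
  | succ N ih =>
    refine ⟨rawMean_isBigO hlam k, fun s => (-(lam + 1 + k) * s ^ (-1 : ℤ) * centredMean lam 0 (-s) k
        + 3 * s ^ (-1 : ℤ) * centredMean lam 0 (-s) (k + 3)
        + centredMean lam 0 (-s) k
          * ((lam + 1) * s ^ (-1 : ℤ) + -3 * s ^ (-1 : ℤ) * centredMean lam 0 (-s) 3)), ?_, ?_⟩
    · filter_upwards [eventually_gt_atTop (0 : ℝ)] with s hs using rawMean_hasDerivAt hlam hs k
    · refine SymbolUpTo.add (.add ?_ ?_) ?_
      · exact ((SymbolUpTo.zpow N _ (-1)).mul (ih k)).mono (by omega)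
      · exact ((SymbolUpTo.zpow N _ (-1)).mul (ih (k + 3))).mono (by push_cast; omega)
      · refine ((ih k).mul (n := -1) (.add (.zpow N _ _) ?_)).mono (by omega)
        exact ((SymbolUpTo.zpow N _ (-1)).mul (ih 3)).mono (by norm_num)

/-- Start from s E[u] = λ + 1 - 3E[u³] and reduce E[u³] to E[u²], then E[u], then 1. The error left
over is the combination of E[u³], E[u⁴], E[u⁵] below, each term of order s⁻⁷. -/
theorem beta_one_neg_expansion (hlam : -1 < lam) :
    Symbol (-7) fun s => beta lam 1 (-s) - ((lam + 1) * s ^ (-1 : ℤ)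
      + -3 * (lam + 1) * ((lam + 3) * (lam + 2)) * s ^ (-4 : ℤ)) := by
  have h3 := (rawMean_symbol hlam 3).zpow_mul (9 * (lam + 3) * (lam + 2)) (-4)
  have h4 := (rawMean_symbol hlam 4).zpow_mul (9 * (lam + 3)) (-3)
  have h5 := (rawMean_symbol hlam 5).zpow_mul 9 (-2)
  refine ((h3.add h4).add h5).congr ?_
  filter_upwards [eventually_gt_atTop (0 : ℝ)] with s hs
  have e0 := rawMean_recurrence hlam s 0
  have e1 := rawMean_recurrence hlam s 1
  have e2 := rawMean_recurrence hlam s 2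
  rw [centredMean_zero hlam] at e0
  norm_num at e0 e1 e2
  rw [beta_one_eq hlam 0, zero_add]
  have z1 : s ^ (-1 : ℤ) = s⁻¹ := zpow_neg_one s
  have z2 : s ^ (-2 : ℤ) = (s ^ 2)⁻¹ := zpow_neg s 2
  have z3 : s ^ (-3 : ℤ) = (s ^ 3)⁻¹ := zpow_neg s 3
  have z4 : s ^ (-4 : ℤ) = (s ^ 4)⁻¹ := zpow_neg s 4
  rw [z1, z2, z3, z4]
  field_simp
  linear_combination (-s ^ 3 + 3 * (lam + 3) * (lam + 2)) * e0 + 3 * (lam + 3) * s * e1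
    + 3 * s ^ 2 * e2

theorem beta_neg_expansion (hlam : -1 < lam) (n : ℕ) :
    (Symbol (-7) fun s => beta lam (2 * n) (-s) - (n * s ^ (-1 : ℤ)
      + -3 * n * (10 * n ^ 2 + 6 * (2 * lam + 1) * n + 3 * lam ^ 2 + 3 * lam + 2)
        * s ^ (-4 : ℤ))) ∧
    (Symbol (-7) fun s => beta lam (2 * n + 1) (-s) - ((n + lam + 1) * s ^ (-1 : ℤ)
      + -3 * (n + lam + 1) * (10 * n ^ 2 + (8 * lam + 14) * n + (lam + 3) * (lam + 2))
        * s ^ (-4 : ℤ))) := by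
  have hderiv : ∀ k : ℕ, ∀ s : ℝ, HasDerivAt (fun s => beta lam (k + 1) (-s))
      (-(beta lam (k + 1) (-s) * (beta lam (k + 2) (-s) - beta lam k (-s)))) s := fun k s =>
    ((hasDerivAt_beta hlam k (-s)).comp s (hasDerivAt_neg s)).congr_deriv (by ring)
  have hstep : ∀ (k : ℕ) (p q : ℝ), p ≠ 0 →
      (Symbol (-7) fun s => beta lam (k + 1) (-s) - (p * s ^ (-1 : ℤ) + q * s ^ (-4 : ℤ))) →
      Symbol (-7) fun s => beta lam (k + 2) (-s) - beta lam k (-s)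
        - (s ^ (-1 : ℤ) + 3 * (q / p) * s ^ (-4 : ℤ)) := by
    intro k p q hp h
    refine (Symbol.volterra_step (l := 0) (κ := -1) (m := -1) (q := q) hp (h.mono (by norm_num))
      (b₁ := fun s => beta lam (k + 1) (-s)) (b₀ := fun s => beta lam k (-s))
      (b₂ := fun s => beta lam (k + 2) (-s))
      (.of_forall fun s => ?_) (.of_forall fun s => hderiv k s) (.of_forall fun s => ?_)).congr
      (.of_forall fun s => ?_)
    · norm_num
    · have := (beta_succ_pos hlam (-s) k).ne'
      simp only [zpow_zero]
      field_simp
      ring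
    · norm_num
  induction n with
  | zero =>
    refine ⟨(Symbol.zpow 0 (-7)).congr (.of_forall fun s => by simp [beta_zero]),
      (beta_one_neg_expansion hlam).congr (.of_forall fun s => ?_)⟩
    simp
  | succ n ih =>
    have hp1 : (n : ℝ) + lam + 1 ≠ 0 := by
      have : (0 : ℝ) ≤ n := n.cast_nonneg
      linarith
    have hp2 : ((n + 1 : ℕ) : ℝ) ≠ 0 := by positivity
    have heven := ((hstep _ _ _ hp1 ih.2).add ih.1).congr
      (g := fun s => beta lam (2 * (n + 1)) (-s) - (((n + 1 : ℕ) : ℝ) * s ^ (-1 : ℤ)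
        + -3 * ((n + 1 : ℕ) : ℝ) * (10 * ((n + 1 : ℕ) : ℝ) ^ 2
          + 6 * (2 * lam + 1) * ((n + 1 : ℕ) : ℝ) + 3 * lam ^ 2 + 3 * lam + 2)
            * s ^ (-4 : ℤ))) (.of_forall fun s => by
        simp only [show 2 * (n + 1) = 2 * n + 2 by ring]
        push_cast
        field_simp
        ring)
    refine ⟨heven, ((hstep (2 * n + 1) _ _ hp2 heven).add ih.2).congr (.of_forall fun s => ?_)⟩
    simp only [show 2 * (n + 1) + 1 = 2 * n + 1 + 2 by ring]
    push_cast at hp2 ⊢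
    field_simp
    ring

end AtBot

/-! ### The limit t → +∞: means centred at the saddle point. -/

/-- The mean of `(x² - a) ^ j` for `t = 3 a²`, where `a` is the saddle point of
`-u³ + 3 a² u`. -/
def saddleMean (lam : ℝ) (j : ℕ) (a : ℝ) : ℝ := centredMean lam a (3 * a ^ 2) j

/-- The mean of `x² (x² - a) ^ j` for `t = 3 a²`. -/
def weightedSaddleMean (lam : ℝ) (j : ℕ) (a : ℝ) : ℝ :=
  saddleMean lam (j + 1) a + a * saddleMean lam j a

section AtTop

variable {lam : ℝ}

theorem saddleMean_zero (hlam : -1 < lam) (a : ℝ) : saddleMean lam 0 a = 1 :=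
  centredMean_zero hlam _ _

theorem saddleMean_recurrence (hlam : -1 < lam) (j : ℕ) (a : ℝ) :
    (lam + 1 + j) * saddleMean lam j a + j * a * saddleMean lam (j - 1) a
      = 3 * saddleMean lam (j + 3) a + 9 * a * saddleMean lam (j + 2) a
        + 6 * a ^ 2 * saddleMean lam (j + 1) a := by
  have h := centredMean_recurrence hlam a (3 * a ^ 2) j
  simp only [saddleMean]
  linear_combination h

theorem saddleMean_succ (hlam : -1 < lam) (j : ℕ) {a : ℝ} (ha : 0 < a) :
    saddleMean lam (j + 1) a = (lam + 1 + j) / 6 * a ^ (-2 : ℤ) * saddleMean lam j a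
      + j / 6 * a ^ (-1 : ℤ) * saddleMean lam (j - 1) a
      + -1 / 2 * a ^ (-2 : ℤ) * saddleMean lam (j + 3) a
      + -3 / 2 * a ^ (-1 : ℤ) * saddleMean lam (j + 2) a := by
  have h := saddleMean_recurrence hlam j a
  rw [zpow_neg_one, show a ^ (-2 : ℤ) = (a ^ 2)⁻¹ from zpow_neg a 2]
  field_simp
  linarith

/-- An extra factor u in the weight amounts to replacing λ by λ + 1, hence the same recurrence with
λ + 2 + j. -/
theorem weightedSaddleMean_recurrence (hlam : -1 < lam) (j : ℕ) (a : ℝ) :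
    (lam + 2 + j) * weightedSaddleMean lam j a + j * a * weightedSaddleMean lam (j - 1) a
      = 3 * weightedSaddleMean lam (j + 3) a + 9 * a * weightedSaddleMean lam (j + 2) a
        + 6 * a ^ 2 * weightedSaddleMean lam (j + 1) a := by
  have h := saddleMean_recurrence hlam j a
  have h' := saddleMean_recurrence hlam (j + 1) a
  simp only [weightedSaddleMean, Nat.add_sub_cancel, add_assoc] at h' ⊢
  norm_num at h' ⊢
  rcases j with - | j
  · norm_num at h h' ⊢
    linear_combination h' + a * h
  · simp only [Nat.add_sub_cancel] at h h' ⊢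
    push_cast at h h' ⊢
    linear_combination h' + a * h

theorem weightedSaddleMean_succ (hlam : -1 < lam) (j : ℕ) {a : ℝ} (ha : 0 < a) :
    weightedSaddleMean lam (j + 1) a = (lam + 2 + j) / 6 * a ^ (-2 : ℤ) * weightedSaddleMean lam j a
      + j / 6 * a ^ (-1 : ℤ) * weightedSaddleMean lam (j - 1) a
      + -1 / 2 * a ^ (-2 : ℤ) * weightedSaddleMean lam (j + 3) a
      + -3 / 2 * a ^ (-1 : ℤ) * weightedSaddleMean lam (j + 2) a := by
  have h := weightedSaddleMean_recurrence hlam j a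
  rw [zpow_neg_one, show a ^ (-2 : ℤ) = (a ^ 2)⁻¹ from zpow_neg a 2]
  field_simp
  linarith

theorem saddleMean_mul (hlam : -1 < lam) (j : ℕ) (a : ℝ) :
    saddleMean lam j a * centredMoment lam a (3 * a ^ 2) 0
      = moment lam (3 * a ^ 2) ((X ^ 2 - C a) ^ j) := centredMean_mul hlam _ _ j

theorem weightedSaddleMean_mul (hlam : -1 < lam) (j : ℕ) (a : ℝ) :
    weightedSaddleMean lam j a * centredMoment lam a (3 * a ^ 2) 0
      = moment lam (3 * a ^ 2) (X ^ 2 * (X ^ 2 - C a) ^ j) := by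
  rw [moment_X_sq_mul hlam, weightedSaddleMean, add_mul, mul_assoc, saddleMean_mul hlam,
    saddleMean_mul hlam, centredMoment, centredMoment]

theorem saddleMean_even_nonneg (hlam : -1 < lam) (i : ℕ) (a : ℝ) :
    0 ≤ saddleMean lam (2 * i) a := by
  refine centredMean_nonneg_of hlam _ _ (fun x => ?_) (saddleMean_mul hlam (2 * i) a).symm
  rw [eval_pow]
  exact (even_two_mul i).pow_nonneg _

theorem weightedSaddleMean_even_nonneg (hlam : -1 < lam) (i : ℕ) (a : ℝ) :
    0 ≤ weightedSaddleMean lam (2 * i) a := by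
  refine centredMean_nonneg_of hlam _ _ (fun x => ?_) (weightedSaddleMean_mul hlam (2 * i) a).symm
  simp only [eval_mul, eval_pow, eval_X]
  exact mul_nonneg (sq_nonneg _) ((even_two_mul i).pow_nonneg _)

/-- `E[u² (u - a) ^ (2 i)] ≥ 0`, where `u = x²`. -/
theorem weightedSaddleMean_sq_nonneg (hlam : -1 < lam) (i : ℕ) (a : ℝ) :
    0 ≤ weightedSaddleMean lam (2 * i + 1) a + a * weightedSaddleMean lam (2 * i) a := by
  refine centredMean_nonneg_of hlam (c := a) (t := 3 * a ^ 2)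
    (X ^ 2 * (X ^ 2 - C a) ^ (2 * i + 1) + C a * (X ^ 2 * (X ^ 2 - C a) ^ (2 * i))) _
    (fun x => ?_) ?_
  · have h : 0 ≤ x ^ 4 * (x ^ 2 - a) ^ (2 * i) :=
      mul_nonneg (by positivity) ((even_two_mul i).pow_nonneg _)
    simp only [eval_add, eval_mul, eval_pow, eval_sub, eval_X, eval_C, pow_succ _ (2 * i)]
    linarith
  · rw [moment_add hlam, moment_smul, ← weightedSaddleMean_mul hlam,
      ← weightedSaddleMean_mul hlam]
    ring

/-- From 1 + v² ± v ≥ 0 with v = x² - a, multiplied by x² v^(2i). -/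
theorem abs_weightedSaddleMean_odd_le (hlam : -1 < lam) (i : ℕ) (a : ℝ) :
    |weightedSaddleMean lam (2 * i + 1) a|
      ≤ weightedSaddleMean lam (2 * i) a + weightedSaddleMean lam (2 * (i + 1)) a := by
  have key : ∀ σ : ℝ, σ ^ 2 = 1 → 0 ≤ weightedSaddleMean lam (2 * i) a
      + weightedSaddleMean lam (2 * (i + 1)) a + σ * weightedSaddleMean lam (2 * i + 1) a := by
    intro σ hσ
    refine centredMean_nonneg_of hlam (c := a) (t := 3 * a ^ 2)
      (X ^ 2 * (X ^ 2 - C a) ^ (2 * i) + X ^ 2 * (X ^ 2 - C a) ^ (2 * (i + 1))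
        + C σ * (X ^ 2 * (X ^ 2 - C a) ^ (2 * i + 1))) _ (fun x => ?_) ?_
    · have h : 0 ≤ x ^ 2 * (x ^ 2 - a) ^ (2 * i)
          * (1 + (x ^ 2 - a) ^ 2 + σ * (x ^ 2 - a)) :=
        mul_nonneg (mul_nonneg (sq_nonneg _) ((even_two_mul i).pow_nonneg _))
          (by nlinarith [sq_nonneg (σ + (x ^ 2 - a)), sq_nonneg (x ^ 2 - a)])
      simp only [eval_add, eval_mul, eval_pow, eval_sub, eval_X, eval_C, mul_add, mul_one,
        pow_succ _ (2 * i), pow_add _ (2 * i) 2] at h ⊢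
      linarith
    · rw [moment_add hlam, moment_add hlam, moment_smul, ← weightedSaddleMean_mul hlam,
        ← weightedSaddleMean_mul hlam, ← weightedSaddleMean_mul hlam]
      ring
  have h1 := key 1 (by norm_num)
  have h2 := key (-1) (by norm_num)
  rw [abs_le]
  constructor <;> linarith

/-- In the recurrence at j = 0 the higher terms are 3E[v²(v + 3a)] = 3E[v²(u + 2a)] ≥ 0, with v = u
- a; hence 6a² E[v] ≤ λ + 1. -/
theorem saddleMean_one_le (hlam : -1 < lam) {a : ℝ} (ha : 1 ≤ a) :
    saddleMean lam 1 a ≤ lam + 1 := by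
  have h0 := saddleMean_recurrence hlam 0 a
  have h : 0 ≤ saddleMean lam 3 a + 3 * a * saddleMean lam 2 a := by
    refine centredMean_nonneg_of hlam (c := a) (t := 3 * a ^ 2)
      ((X ^ 2 - C a) ^ 3 + C (3 * a) * (X ^ 2 - C a) ^ 2) _ (fun x => ?_) ?_
    · have h : 0 ≤ (x ^ 2 - a) ^ 2 * (x ^ 2 + 2 * a) :=
        mul_nonneg (sq_nonneg _) (by nlinarith [sq_nonneg x])
      simp only [eval_add, eval_mul, eval_pow, eval_sub, eval_X, eval_C]
      linarith
    · rw [moment_add hlam, moment_smul, ← saddleMean_mul hlam, ← saddleMean_mul hlam]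
      ring
  rw [saddleMean_zero hlam] at h0
  norm_num at h0
  have h1 : a ^ 2 * saddleMean lam 1 a ≤ lam + 1 := by
    by_contra! h'
    nlinarith
  by_contra! h'
  have : saddleMean lam 1 a ≤ a ^ 2 * saddleMean lam 1 a :=
    le_mul_of_one_le_left (by linarith) (one_le_pow₀ ha)
  linarith

/-- With v = u - a, the right side of the recurrence at j = 2i + 1 is 3E[v^(2i+2) u(u + a)], since
(v + a)(v + 2a) = u(u + a). Discard E[u² v^(2i+2)] ≥ 0 there and (λ + 1) a E[v^(2i)] ≥ 0 on the
left. The factor u vanishes at the endpoint u = 0, which is why the argument bounds the means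
weighted by u first. -/
theorem weightedSaddleMean_even_succ_le (hlam : -1 < lam) (i : ℕ) {a : ℝ} (ha : 0 < a) :
    3 * a * weightedSaddleMean lam (2 * (i + 1)) a
      ≤ (lam + 2 * i + 2) * weightedSaddleMean lam (2 * i) a := by
  have h := saddleMean_recurrence hlam (2 * i + 1) a
  have h1 := weightedSaddleMean_sq_nonneg hlam (i + 1) a
  have h2 := mul_nonneg (mul_nonneg (by linarith : 0 ≤ lam + 1) ha.le)
    (saddleMean_even_nonneg hlam i a)
  simp only [weightedSaddleMean, mul_add, mul_one, add_assoc, Nat.add_sub_cancel] at h h1 ⊢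
  norm_num at h h1 ⊢
  linarith

theorem weightedSaddleMean_even_isBigO (hlam : -1 < lam) (i : ℕ) :
    SymbolUpTo 0 (1 - i) (weightedSaddleMean lam (2 * i)) := by
  induction i with
  | zero =>
    refine IsBigO.of_bound (lam + 2) ?_
    filter_upwards [eventually_ge_atTop (1 : ℝ)] with a ha
    have h1 := saddleMean_one_le hlam ha
    have h2 := weightedSaddleMean_even_nonneg hlam 0 a
    rw [Real.norm_of_nonneg h2]
    simp only [weightedSaddleMean, mul_zero, zero_add, saddleMean_zero hlam, Nat.cast_zero,
      sub_zero, zpow_one, mul_one]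
    rw [Real.norm_of_nonneg (by linarith)]
    nlinarith
  | succ i ih =>
    refine IsBigO.trans ?_ (((SymbolUpTo.zpow 0 1 (-1)).mul ih).mono
      (n := 1 - ((i + 1 : ℕ) : ℤ)) (by push_cast; omega)).isBigO
    refine IsBigO.of_bound (lam + 2 * i + 2) ?_
    filter_upwards [eventually_gt_atTop (0 : ℝ)] with a ha
    have h1 := weightedSaddleMean_even_nonneg hlam i a
    have h2 := weightedSaddleMean_even_nonneg hlam (i + 1) a
    have h3 := weightedSaddleMean_even_succ_le hlam i ha
    have h4 := mul_nonneg ha.le h2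
    rw [zpow_neg_one, Real.norm_of_nonneg h2, Real.norm_of_nonneg (by positivity), one_mul,
      ← mul_assoc, mul_comm _ a⁻¹, mul_assoc, inv_mul_eq_div, le_div_iff₀ ha]
    linarith

/-- The crude bound by even neighbours loses a². The recurrence repairs this: the next odd mean
appears in it with coefficient a⁻², so the crude bound suffices there, and the previous odd mean is
covered by induction. -/
theorem weightedSaddleMean_odd_isBigO (hlam : -1 < lam) (i : ℕ) :
    SymbolUpTo 0 (-1 - i) (weightedSaddleMean lam (2 * i + 1)) := by
  have hcrude : ∀ i : ℕ, SymbolUpTo 0 (1 - i) (weightedSaddleMean lam (2 * i + 1)) := by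
    intro i
    refine IsBigO.trans (IsBigO.of_bound 1 (.of_forall fun a => ?_))
      ((weightedSaddleMean_even_isBigO hlam i).add
        ((weightedSaddleMean_even_isBigO hlam (i + 1)).mono (by push_cast; omega))).isBigO
    rw [one_mul, Real.norm_eq_abs]
    exact (abs_weightedSaddleMean_odd_le hlam i a).trans (le_abs_self _)
  have hrest : ∀ i : ℕ, SymbolUpTo 0 (-1 - i) fun a =>
      (lam + 2 + (2 * i : ℕ)) / 6 * a ^ (-2 : ℤ) * weightedSaddleMean lam (2 * i) a
        + -1 / 2 * a ^ (-2 : ℤ) * weightedSaddleMean lam (2 * i + 3) a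
        + -3 / 2 * a ^ (-1 : ℤ) * weightedSaddleMean lam (2 * i + 2) a := fun i =>
    ((((SymbolUpTo.zpow 0 _ (-2)).mul (weightedSaddleMean_even_isBigO hlam i)).mono
      (by omega)).add (((SymbolUpTo.zpow 0 _ (-2)).mul (hcrude (i + 1))).mono
      (by push_cast; omega))).add
      (((SymbolUpTo.zpow 0 _ (-1)).mul (weightedSaddleMean_even_isBigO hlam (i + 1))).mono
      (by push_cast; omega))
  induction i with
  | zero =>
    refine (hrest 0).congr ?_
    filter_upwards [eventually_gt_atTop (0 : ℝ)] with a ha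
    have h := weightedSaddleMean_succ hlam 0 ha
    norm_num at h ⊢
    linarith
  | succ i ih =>
    refine ((hrest (i + 1)).add (((SymbolUpTo.zpow 0 ((2 * (i + 1) : ℕ) / 6) (-1)).mul ih).mono
      (by push_cast; omega))).congr ?_
    filter_upwards [eventually_gt_atTop (0 : ℝ)] with a ha
    rw [weightedSaddleMean_succ hlam (2 * (i + 1)) ha, show 2 * (i + 1) - 1 = 2 * i + 1 by omega]
    ring

/-- Writing E_j and W_j for the unweighted and weighted means, the recurrence at even j = 2i
regroups as (λ + 1)E_j = 3W_{j+2} + 6aW_{j+1} - jW_{j-1}. As λ + 1 ≠ 0, this removes the weight u at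
even indices. Odd indices follow from aE_{j+1} = W_{j+1} - E_{j+2}. -/
theorem saddleMean_isBigO (hlam : -1 < lam) (i : ℕ) :
    SymbolUpTo 0 (-i) (saddleMean lam (2 * i)) ∧
      SymbolUpTo 0 (-i - 2) (saddleMean lam (2 * i + 1)) := by
  have hl : lam + 1 ≠ 0 := by linarith
  have heven : ∀ i : ℕ, SymbolUpTo 0 (-i) (saddleMean lam (2 * i)) := by
    intro i
    have h1 := ((SymbolUpTo.zpow 0 (3 / (lam + 1)) 0).mul
      (weightedSaddleMean_even_isBigO hlam (i + 1))).mono (n := -i) (by push_cast; omega)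
    have h2 := ((SymbolUpTo.zpow 0 (6 / (lam + 1)) 1).mul
      (weightedSaddleMean_odd_isBigO hlam i)).mono (n := -i) (by omega)
    rcases i with - | i
    · simpa [saddleMean_zero hlam, funext (saddleMean_zero hlam)] using SymbolUpTo.zpow 0 1 0
    · have h3 := ((SymbolUpTo.zpow 0 (-(2 * (i + 1)) / (lam + 1)) 0).mul
        (weightedSaddleMean_odd_isBigO hlam i)).mono (n := -(i + 1 : ℕ)) (by push_cast; omega)
      refine ((h1.add h2).add h3).congr (.of_forall fun a => ?_)
      have h := saddleMean_recurrence hlam (2 * (i + 1)) a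
      simp only [weightedSaddleMean, zpow_zero, zpow_one, mul_add, mul_one, add_assoc] at h ⊢
      norm_num at h ⊢
      field_simp
      linarith
  refine ⟨heven i, ?_⟩
  refine (((SymbolUpTo.zpow 0 1 (-1)).mul (weightedSaddleMean_odd_isBigO hlam i)).mono
    (n := -i - 2) (by omega)).add (((SymbolUpTo.zpow 0 (-1) (-1)).mul (heven (i + 1))).mono
    (by push_cast; omega)) |>.congr ?_
  filter_upwards [eventually_gt_atTop (0 : ℝ)] with a ha
  simp only [weightedSaddleMean, zpow_neg_one, mul_add, mul_one, add_assoc]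
  norm_num
  field_simp

/-- The raw derivative contains 6aE_{j+1} - jE_{j-1}, whose two terms are individually too large
when j is odd. The recurrence replaces the difference by terms that visibly gain a⁻¹ over the bound
for E_j. -/
theorem hasDerivAt_saddleMean (hlam : -1 < lam) (j : ℕ) {a : ℝ} (ha : 0 < a) :
    HasDerivAt (saddleMean lam j)
      ((lam + 1 + j) * a ^ (-1 : ℤ) * saddleMean lam j a
        + -3 * a ^ (-1 : ℤ) * saddleMean lam (j + 3) a + -9 * a ^ (0 : ℤ) * saddleMean lam (j + 2) a
        + saddleMean lam j a * (-(lam + 1) * a ^ (-1 : ℤ)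
          + 3 * a ^ (-1 : ℤ) * saddleMean lam 3 a + 9 * a ^ (0 : ℤ) * saddleMean lam 2 a)) a := by
  have h3 : HasDerivAt (fun a : ℝ => 3 * a ^ 2) (6 * a) a :=
    ((hasDerivAt_pow 2 a).const_mul 3).congr_deriv (by push_cast; ring)
  refine (hasDerivAt_centredMean hlam (hasDerivAt_id a) h3 j).congr_deriv ?_
  have h1 := saddleMean_recurrence hlam j a
  have h2 := saddleMean_recurrence hlam 0 a
  rw [saddleMean_zero hlam] at h2
  simp only [zero_add, Nat.cast_zero, add_zero, zero_mul, mul_one] at h2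
  simp only [id, saddleMean] at h1 h2 ⊢
  generalize 3 * a ^ 2 = τ at h1 h2 ⊢
  rw [zpow_neg_one, zpow_zero]
  field_simp
  linear_combination (-1) * h1 + centredMean lam a τ j * h2

theorem saddleMean_symbol (hlam : -1 < lam) (i : ℕ) :
    Symbol (-i) (saddleMean lam (2 * i)) ∧ Symbol (-i - 2) (saddleMean lam (2 * i + 1)) := by
  suffices h : ∀ N : ℕ, ∀ i : ℕ, SymbolUpTo N (-i) (saddleMean lam (2 * i)) ∧
      SymbolUpTo N (-i - 2) (saddleMean lam (2 * i + 1)) from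
    ⟨fun N => (h N i).1, fun N => (h N i).2⟩
  intro N
  induction N with
  | zero => exact saddleMean_isBigO hlam
  | succ N ih =>
    have hz := SymbolUpTo.zpow N
    have hlog : SymbolUpTo N (-1) fun a => -(lam + 1) * a ^ (-1 : ℤ)
        + 3 * a ^ (-1 : ℤ) * saddleMean lam 3 a + 9 * a ^ (0 : ℤ) * saddleMean lam 2 a :=
      ((hz _ _).add (((hz _ (-1)).mul (ih 1).2).mono (by norm_num))).add
        (((hz _ 0).mul (ih 1).1).mono (by norm_num))
    intro i
    refine ⟨⟨(saddleMean_isBigO hlam i).1, _, eventually_gt_atTop (0 : ℝ) |>.mono fun a ha =>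
      hasDerivAt_saddleMean hlam (2 * i) ha, .add (.add (.add ?_ ?_) ?_) ?_⟩,
      ⟨(saddleMean_isBigO hlam i).2, _, eventually_gt_atTop (0 : ℝ) |>.mono fun a ha =>
      hasDerivAt_saddleMean hlam (2 * i + 1) ha, .add (.add (.add ?_ ?_) ?_) ?_⟩⟩
    · exact ((hz _ (-1)).mul (ih i).1).mono (by omega)
    · exact ((hz _ (-1)).mul (ih (i + 1)).2).mono (by push_cast; omega)
    · exact ((hz _ 0).mul (ih (i + 1)).1).mono (by push_cast; omega)
    · exact ((ih i).1.mul hlog).mono (by omega)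
    · exact ((hz _ (-1)).mul (ih i).2).mono (by omega)
    · exact ((hz _ (-1)).mul (ih (i + 2)).1).mono (by push_cast; omega)
    · exact ((hz _ 0).mul (ih (i + 1)).2).mono (by push_cast; omega)
    · exact ((ih i).2.mul hlog).mono (by omega)

theorem saddleMean_one_expansion (hlam : -1 < lam) :
    Symbol (-8) fun a => saddleMean lam 1 a - ((2 * lam - 1) / 12 * a ^ (-2 : ℤ)
      + -(12 * lam ^ 2 - 24 * lam + 5) / 288 * a ^ (-5 : ℤ)) := by
  have hz : ∀ (a : ℝ), a ^ (-1 : ℤ) = a⁻¹ ∧ a ^ (-2 : ℤ) = a⁻¹ ^ 2 ∧ a ^ (-3 : ℤ) = a⁻¹ ^ 3 ∧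
      a ^ (-4 : ℤ) = a⁻¹ ^ 4 ∧ a ^ (-5 : ℤ) = a⁻¹ ^ 5 := fun a =>
    ⟨zpow_neg_one a, (inv_zpow' a 2).symm, (inv_zpow' a 3).symm, (inv_zpow' a 4).symm,
      (inv_zpow' a 5).symm⟩
  have e1 := (saddleMean_symbol hlam 0).2
  have e2 := (saddleMean_symbol hlam 1).1
  have e3 := (saddleMean_symbol hlam 1).2
  have e4 := (saddleMean_symbol hlam 2).1
  have e5 := (saddleMean_symbol hlam 2).2
  have e6 := (saddleMean_symbol hlam 3).1
  norm_num at e1 e2 e3 e4 e5 e6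
  have r1 := fun (a : ℝ) (ha : 0 < a) => saddleMean_succ hlam 0 ha
  have r2 := fun (a : ℝ) (ha : 0 < a) => saddleMean_succ hlam 1 ha
  have r3 := fun (a : ℝ) (ha : 0 < a) => saddleMean_succ hlam 2 ha
  have r4 := fun (a : ℝ) (ha : 0 < a) => saddleMean_succ hlam 3 ha
  norm_num [saddleMean_zero hlam] at r1 r2 r3 r4
  -- Bootstrap: leading terms of the means of index 2, 1, 4, 3, each feeding the next, give the
  -- second term at index 2 and finally the second term at index 1.
  have s2 : Symbol (-4) fun a => saddleMean lam 2 a - 1 / 6 * a ^ (-1 : ℤ) := by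
    refine Symbol.congr (((e1.zpow_mul_of_le ((lam + 2) / 6) (-2)).add (e4.zpow_mul_of_le (-1 / 2) (-2))).add
      (e3.zpow_mul_of_le (-3 / 2) (-1))) ?_
    filter_upwards [eventually_gt_atTop (0 : ℝ)] with a ha
    obtain ⟨z1, z2, -, -, -⟩ := hz a
    rw [r2 a ha]
    simp only [z1, z2]
    ring
  have s1 : Symbol (-5) fun a => saddleMean lam 1 a - (2 * lam - 1) / 12 * a ^ (-2 : ℤ) := by
    refine Symbol.congr ((e3.zpow_mul_of_le (-1 / 2) (-2)).add (s2.zpow_mul_of_le (-3 / 2) (-1))) ?_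
    filter_upwards [eventually_gt_atTop (0 : ℝ)] with a ha
    obtain ⟨z1, z2, -, -, -⟩ := hz a
    rw [r1 a ha]
    simp only [z1, z2]
    ring
  have s4 : Symbol (-5) fun a => saddleMean lam 4 a - 1 / 12 * a ^ (-2 : ℤ) := by
    refine Symbol.congr ((((e3.zpow_mul_of_le ((lam + 4) / 6) (-2)).add (s2.zpow_mul_of_le (1 / 2) (-1))).add
      (e6.zpow_mul_of_le (-1 / 2) (-2))).add (e5.zpow_mul_of_le (-3 / 2) (-1))) ?_
    filter_upwards [eventually_gt_atTop (0 : ℝ)] with a ha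
    obtain ⟨z1, z2, -, -, -⟩ := hz a
    rw [r4 a ha]
    simp only [z1, z2]
    ring
  have s3 : Symbol (-6) fun a => saddleMean lam 3 a - (6 * lam - 5) / 72 * a ^ (-3 : ℤ) := by
    refine Symbol.congr ((((s2.zpow_mul_of_le ((lam + 3) / 6) (-2)).add (s1.zpow_mul_of_le (1 / 3) (-1))).add
      (e5.zpow_mul_of_le (-1 / 2) (-2))).add (s4.zpow_mul_of_le (-3 / 2) (-1))) ?_
    filter_upwards [eventually_gt_atTop (0 : ℝ)] with a ha
    obtain ⟨z1, z2, z3, -, -⟩ := hz a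
    rw [r3 a ha]
    simp only [z1, z2, z3]
    ring
  have s2' : Symbol (-7) fun a => saddleMean lam 2 a
      - (1 / 6 * a ^ (-1 : ℤ) + (4 * lam ^ 2 - 12 * lam + 5) / 144 * a ^ (-4 : ℤ)) := by
    refine Symbol.congr (((s1.zpow_mul_of_le ((lam + 2) / 6) (-2)).add (s4.zpow_mul_of_le (-1 / 2) (-2))).add
      (s3.zpow_mul_of_le (-3 / 2) (-1))) ?_
    filter_upwards [eventually_gt_atTop (0 : ℝ)] with a ha
    obtain ⟨z1, z2, z3, z4, -⟩ := hz a
    rw [r2 a ha]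
    simp only [z1, z2, z3, z4]
    ring
  refine Symbol.congr ((s3.zpow_mul_of_le (-1 / 2) (-2)).add (s2'.zpow_mul_of_le (-3 / 2) (-1))) ?_
  filter_upwards [eventually_gt_atTop (0 : ℝ)] with a ha
  obtain ⟨z1, z2, z3, z4, z5⟩ := hz a
  rw [r1 a ha]
  simp only [z1, z2, z3, z4, z5]
  ring

theorem beta_saddle_expansion (hlam : -1 < lam) (n : ℕ) :
    (Symbol (-8) fun a => beta lam (2 * n) (3 * a ^ 2) - (n / 6 * a ^ (-2 : ℤ)
      + n * (2 * n - 2 * lam - 1) / 24 * a ^ (-5 : ℤ))) ∧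
    (Symbol (-8) fun a => beta lam (2 * n + 1) (3 * a ^ 2) - (a
      + -(4 * n - 2 * lam + 1) / 12 * a ^ (-2 : ℤ)
      + -(36 * n ^ 2 - 72 * lam * n + 12 * lam ^ 2 - 24 * lam + 5) / 288 * a ^ (-5 : ℤ))) := by
  have hderiv : ∀ k : ℕ, ∀ a : ℝ, HasDerivAt (fun a => beta lam (k + 1) (3 * a ^ 2))
      (6 * a * (beta lam (k + 1) (3 * a ^ 2)
        * (beta lam (k + 2) (3 * a ^ 2) - beta lam k (3 * a ^ 2)))) a := fun k a =>
    (HasDerivAt.comp (h₂ := beta lam (k + 1)) a (hasDerivAt_beta hlam k (3 * a ^ 2))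
      ((hasDerivAt_pow 2 a).const_mul 3)).congr_deriv (by push_cast; ring)
  have hstep : ∀ (k : ℕ) (m : ℤ) (p q : ℝ) (r : ℝ → ℝ), p ≠ 0 → Symbol (m - 6) r →
      (∀ᶠ a in atTop, beta lam (k + 1) (3 * a ^ 2) = p * a ^ m + q * a ^ (m - 3) + r a) →
      Symbol (-8) fun a => beta lam (k + 2) (3 * a ^ 2) - beta lam k (3 * a ^ 2)
        - (m / 6 * a ^ (-2 : ℤ) - q / (2 * p) * a ^ (-5 : ℤ)) := by
    intro k m p q r hp hr h
    refine (Symbol.volterra_step (l := -1) (κ := 1 / 6) (m := m) (q := q) hp hr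
      (b₁ := fun a => beta lam (k + 1) (3 * a ^ 2)) (b₀ := fun a => beta lam k (3 * a ^ 2))
      (b₂ := fun a => beta lam (k + 2) (3 * a ^ 2))
      h (.of_forall fun s => hderiv k s) ?_).congr (.of_forall fun s => ?_)
    · filter_upwards [eventually_gt_atTop (0 : ℝ)] with a ha
      have := (beta_succ_pos hlam (3 * a ^ 2) k).ne'
      rw [zpow_neg_one]
      field_simp
      ring
    · norm_num
      ring
  induction n with
  | zero =>
    refine ⟨(Symbol.zpow 0 (-8)).congr (.of_forall fun s => by simp [beta_zero]),
      (saddleMean_one_expansion hlam).congr (.of_forall fun a => ?_)⟩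
    simp only [mul_zero, zero_add, beta_one_eq hlam a, saddleMean, Nat.cast_zero]
    ring
  | succ n ih =>
    have hp2 : ((n + 1 : ℕ) : ℝ) ≠ 0 := by positivity
    -- For odd index the leading term is a itself, so m = 1 and only relative accuracy a⁻⁶ is
    -- needed: the a⁻⁵ term of β_{2n+1} is absorbed into the remainder.
    have heven := ((hstep (2 * n) 1 1 (-(4 * n - 2 * lam + 1) / 12) _ one_ne_zero
      ((ih.2.mono (by norm_num)).add
        ((Symbol.zpow (-(36 * n ^ 2 - 72 * lam * n + 12 * lam ^ 2 - 24 * lam + 5) / 288)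
          (-5)).mono (by norm_num))) (.of_forall fun a => by norm_num; ring)).add ih.1).congr
      (g := fun a => beta lam (2 * (n + 1)) (3 * a ^ 2) - (((n + 1 : ℕ) : ℝ) / 6 * a ^ (-2 : ℤ)
      + ((n + 1 : ℕ) : ℝ) * (2 * ((n + 1 : ℕ) : ℝ) - 2 * lam - 1) / 24 * a ^ (-5 : ℤ)))
      (.of_forall fun a => by
        simp only [show 2 * (n + 1) = 2 * n + 2 by ring]
        push_cast
        ring)
    refine ⟨heven, ((hstep (2 * n + 1) (-2) (((n + 1 : ℕ) : ℝ) / 6)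
      (((n + 1 : ℕ) : ℝ) * (2 * ((n + 1 : ℕ) : ℝ) - 2 * lam - 1) / 24) _ (by positivity)
      (heven.mono (by norm_num)) (.of_forall fun a => ?_)).add ih.2).congr
      (.of_forall fun a => ?_)⟩
    · simp only [show 2 * (n + 1) = 2 * n + 1 + 1 by ring]
      norm_num
    · simp only [show 2 * (n + 1) + 1 = 2 * n + 1 + 2 by ring]
      push_cast at hp2 ⊢
      field_simp
      ring

end AtTop

end SexticFreud

end

/-! ### Return to the variable t. -/

theorem lemma4p4 (lam : ℝ) (hlam : -1 < lam) (n : ℕ) :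
    ((fun t : ℝ => SexticFreud.beta lam (2 * n) t -
        ((n : ℝ) / (2 * t)
          + 3 * √3 * (n : ℝ) * (2 * (n : ℝ) - 2 * lam - 1) / (8 * t ^ (5 / 2 : ℝ))))
      =O[atTop] fun t : ℝ => t ^ (-4 : ℤ)) ∧
    ((fun t : ℝ => SexticFreud.beta lam (2 * n + 1) t -
        (√(3 * t) / 3 - (4 * (n : ℝ) - 2 * lam + 1) / (4 * t)
          - √3 * (36 * (n : ℝ) ^ 2 - 72 * lam * (n : ℝ) + 12 * lam ^ 2 - 24 * lam + 5)
              / (32 * t ^ (5 / 2 : ℝ))))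
      =O[atTop] fun t : ℝ => t ^ (-4 : ℤ)) ∧
    ((fun t : ℝ => SexticFreud.beta lam (2 * n) t -
        (-(n : ℝ) / t
          - 3 * (n : ℝ) * (10 * (n : ℝ) ^ 2 + 6 * (2 * lam + 1) * (n : ℝ)
              + 3 * lam ^ 2 + 3 * lam + 2) / t ^ 4))
      =O[atBot] fun t : ℝ => t ^ (-7 : ℤ)) ∧
    ((fun t : ℝ => SexticFreud.beta lam (2 * n + 1) t -
        (-((n : ℝ) + lam + 1) / t
          - 3 * ((n : ℝ) + lam + 1) * (10 * (n : ℝ) ^ 2 + (8 * lam + 14) * (n : ℝ)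
              + (lam + 3) * (lam + 2)) / t ^ 4))
      =O[atBot] fun t : ℝ => t ^ (-7 : ℤ)) := by
  have hsaddle : Tendsto (fun t : ℝ => √(t / 3)) atTop atTop :=
    Real.tendsto_sqrt_atTop.comp (tendsto_id.atTop_div_const (by norm_num))
  have hpos : ∀ t : ℝ, 0 < t → 0 < √(t / 3) ∧ t = 3 * √(t / 3) ^ 2 ∧ √(3 * t) = 3 * √(t / 3) ∧
      t ^ (5 / 2 : ℝ) = 9 * √3 * √(t / 3) ^ 5 := by
    intro t ht
    have ha : 0 < √(t / 3) := Real.sqrt_pos.2 (by positivity)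
    have ht2 : t = 3 * √(t / 3) ^ 2 := by rw [Real.sq_sqrt (by positivity)]; ring
    have hs : √t = √3 * √(t / 3) := by
      rw [← Real.sqrt_mul (by norm_num)]; congr 1; ring
    refine ⟨ha, ht2, ?_, ?_⟩
    · rw [Real.sqrt_mul (by norm_num), hs, ← mul_assoc, Real.mul_self_sqrt (by norm_num)]
    · rw [show (5 / 2 : ℝ) = (2 : ℕ) + 1 / 2 by norm_num, Real.rpow_add ht, Real.rpow_natCast,
        ← Real.sqrt_eq_rpow, hs]
      nth_rewrite 1 [ht2]
      ring
  have htop : ∀ {f g : ℝ → ℝ}, (g =O[atTop] fun a : ℝ => a ^ (-8 : ℤ)) →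
      (∀ t > 0, g (√(t / 3)) = f t) → f =O[atTop] fun t : ℝ => t ^ (-4 : ℤ) := by
    intro f g hg hfg
    -- With t = 3a², a⁻⁸ = 3⁴ t⁻⁴, whence the constant 81.
    refine ((hg.comp_tendsto hsaddle).congr' (g₂ := fun t : ℝ => 81 * t ^ (-4 : ℤ)) ?_ ?_).trans
      ((isBigO_refl _ _).const_mul_left 81)
    · filter_upwards [eventually_gt_atTop (0 : ℝ)] with t ht using hfg t ht
    · filter_upwards [eventually_gt_atTop (0 : ℝ)] with t ht
      obtain ⟨ha, ht2, -, -⟩ := hpos t ht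
      simp only [Function.comp_apply]
      generalize √(t / 3) = a at ha ht2
      subst ht2
      rw [show a ^ (-8 : ℤ) = (a ^ 8)⁻¹ from zpow_neg a 8,
        show (3 * a ^ 2) ^ (-4 : ℤ) = ((3 * a ^ 2) ^ 4)⁻¹ from zpow_neg _ 4]
      field_simp
      norm_num
  have hbot : ∀ {f g : ℝ → ℝ}, (g =O[atTop] fun s : ℝ => s ^ (-7 : ℤ)) →
      (∀ t < 0, g (-t) = f t) → f =O[atBot] fun t : ℝ => t ^ (-7 : ℤ) := by
    intro f g hg hfg
    refine ((hg.comp_tendsto tendsto_neg_atBot_atTop).congr'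
      (g₂ := fun t : ℝ => -1 * t ^ (-7 : ℤ)) ?_ (.of_forall fun t => ?_)).trans
      ((isBigO_refl _ _).const_mul_left (-1))
    · filter_upwards [eventually_lt_atBot (0 : ℝ)] with t ht using hfg t ht
    · simp only [Function.comp_apply]
      rw [Odd.neg_zpow (by decide)]
      ring
  have h3 : √3 ≠ 0 := (Real.sqrt_pos.2 (by norm_num)).ne'
  obtain ⟨h1, h2⟩ := SexticFreud.beta_saddle_expansion hlam n
  obtain ⟨i1, i2⟩ := SexticFreud.beta_neg_expansion hlam n
  refine ⟨htop h1.isBigO fun t ht => ?_, htop h2.isBigO fun t ht => ?_,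
    hbot i1.isBigO fun t ht => ?_, hbot i2.isBigO fun t ht => ?_⟩
  · obtain ⟨ha, ht2, -, hr⟩ := hpos t ht
    have z2 : √(t / 3) ^ (-2 : ℤ) = (√(t / 3) ^ 2)⁻¹ := zpow_neg _ 2
    have z5 : √(t / 3) ^ (-5 : ℤ) = (√(t / 3) ^ 5)⁻¹ := zpow_neg _ 5
    rw [hr, z2, z5, ← ht2]
    congr 2
    · nth_rewrite 2 [ht2]
      field_simp
      ring
    · field_simp
      ring
  · obtain ⟨ha, ht2, hs, hr⟩ := hpos t ht
    have z2 : √(t / 3) ^ (-2 : ℤ) = (√(t / 3) ^ 2)⁻¹ := zpow_neg _ 2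
    have z5 : √(t / 3) ^ (-5 : ℤ) = (√(t / 3) ^ 5)⁻¹ := zpow_neg _ 5
    rw [hr, hs, z2, z5, ← ht2]
    congr 1
    nth_rewrite 5 [ht2]
    field_simp
    ring
  all_goals
    have z1 : (-t) ^ (-1 : ℤ) = -t⁻¹ := by rw [zpow_neg_one, inv_neg]
    have z4 : (-t) ^ (-4 : ℤ) = (t ^ 4)⁻¹ := by
      rw [show (-t) ^ (-4 : ℤ) = ((-t) ^ 4)⁻¹ from zpow_neg _ 4]
      ring
    rw [z1, z4, neg_neg]
    ring
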